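/- Setting. Let $(x_i,y_i)_{i\ge 1}$ be i.i.d. with $x_i\in\mathbb R^p$ ($p\ge1$ fixed), where given $x_i$ the response $y_i$ has density $f_0(y;\theta)=\exp[\{y\theta-b(\theta)\}/\phi+c(y,\phi)]$ with respect to a fixed $\sigma$-finite measure, with canonical parameter $\theta=x_i^T\beta_0$ in an open interval $\Theta$, and $\phi>0$. Thus the link $g$ is canonical, $g^{-1}=b'$, and $b''$ is the variance function (written $1/\dot g(x^T\beta)$ when evaluated at $x^T\beta$). The first $N$ observations are partitioned, possibly at random but independently of the data, into a fixed number $K\ge 1$ of sub-datasets $(Y_k,X_k)$ of sizes $n_k$, $N=\sum_k n_k$, $n_{\min}=\min_k n_k$. For a dataset of size $n$ write $$S_n(\beta)=\frac1n\sum_i\{y_i-b'(x_i^T\beta)\}x_i/\phi,\qquad -\dot S_n(\beta)=\frac1n\sum_i b''(x_i^T\beta)x_ix_i^T/\phi .$$ For each $k$ let $\hat\beta_{\lambda,k}$ be a lasso estimator on block $k$, i.e. a maximiser of $\frac1{n_k}\sum_i\{y_ix_i^T\beta-b(x_i^T\beta)\}/\phi-\lambda_k\|\beta\|_1$, with $\lambda_k=(\log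 p/n_k)^{1/2}$; let $\hat\phi_k$ be a consistent estimator of $\phi$ ($\hat\phi_k=\phi$ if $\phi$ is known). With $\phi$ replaced by $\hat\phi_k$ in $S_{n_k}$ and $\dot S_{n_k}$, put $\hat\Sigma_{n_k}=\{-\dot S_{n_k}(\hat\beta_{\lambda,k})\}^{-1}$ and $\hat\beta^c_{\lambda,k}=\hat\beta_{\lambda,k}+\hat\Sigma_{n_k}S_{n_k}(\hat\beta_{\lambda,k})$, and let $\hat h_{n_k}$ be the density of $\mathcal N(\hat\beta^c_{\lambda,k},\hat\Sigma_{n_k}/n_k)$. The divide-and-combine estimator $\hat\beta_{dac}$ is a maximiser of $\beta\mapsto\prod_{k=1}^K\hat h_{n_k}(\beta)$. (Estimators defined as maximisers are only required to be so with probability tending to one.) Conditions, as $n_{\min}\to\infty$. (C1) $E[\{y_1-b'(x_1^T\beta_0)\}x_1/\phi]=0$. There are a set $\mathcal X\subset\mathbb R^p$ that contains every $x_i$ almost surely and a $\delta>0$ such that for each $\beta$ with $\|\beta-\beta_0\|_1<\delta$: $x^T\beta\in\Theta$ for $x\in\mathcal X$; $b''(x^T\beta)$ is bounded, and bounded away from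 zero, over $x\in\mathcal X$; and $|b''(x^T\beta)-b''(x^T\beta_0)|\le L|x^T(\beta-\beta_0)|$ for $x\in\mathcal X$, with a constant $L$. (C2) $\max_k\max_{i,j}|X_{k,ij}|=O_p(1)$, and there are constants $b_*,B_*>0$ such that, with probability tending to one, all singular values of $n_k^{-1/2}X_k$, $k=1,\dots,K$, lie in $[b_*,B_*]$. (C3) $p<n_{\min}$ eventually; with $s_0=\#\{j:\beta_{0,j}\ne0\}$, $s_0\log p/n_{\min}^{1/2}\to0$; and for each $k$, $\|\hat\beta_{\lambda,k}-\beta_0\|_1=O_p(s_0\lambda_k)$ and $n_k^{-1}\|X_k(\hat\beta_{\lambda,k}-\beta_0)\|_2^2=O_p(s_0\lambda_k^2)$. Theorem. Under (C1)–(C3), as $n_{\min}\to\infty$ with $K$ fixed: (i) with probability tending to one, $\hat\beta_{dac}$ is the unique maximiser of $\prod_k\hat h_{n_k}$ and $$\hat\beta_{dac}=\Big\{\sum_{k}n_k\hat\Sigma_{n_k}^{-1}\Big\}^{-1}\sum_{k}n_k\hat\Sigma_{n_k}^{-1}\hat\beta^c_{\lambda,k};$$ (ii) $\hat\beta_{dac}\to\beta_0$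 in probability; (iii) the full-data Fisher information $\Sigma_{dac}^{-1}(\beta_0)=E\{-\dot S_N(\beta_0)\}=E\{b''(x_1^T\beta_0)x_1x_1^T/\phi\}$ is positive definite, and $$N^{1/2}(\hat\beta_{dac}-\beta_0)\overset{d}{\to}\mathcal N(0,\Sigma_{dac}(\beta_0));$$ (iv) $\hat\beta_{dac}$ is asymptotically as efficient as the full-data maximum likelihood estimator: if $\hat\beta_{full}$ maximises the likelihood $\prod_{i=1}^N f_0(y_i;x_i^T\beta)$, then also $N^{1/2}(\hat\beta_{full}-\beta_0)\overset{d}{\to}\mathcal N(0,\Sigma_{dac}(\beta_0))$. -/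

import Mathlib

open MeasureTheory ProbabilityTheory Filter Matrix
open scoped Topology ENNReal

noncomputable section

namespace DivideCombine

/-! ### Generalised linear models with canonical link -/

/-- A one-parameter exponential dispersion family with canonical parameter `θ` in the open
interval `Θ`, cumulant function `b`, dispersion `φ`, and density
`exp ((y θ - b θ) / φ + c y)` with respect to the measure `ν`
(Lebesgue measure or counting measure, say); `c y` stands for `c (y, φ)`. -/
structure ExpFamily where
  ν : Measure ℝ
  sigmaFinite : SigmaFinite ν
  Θ : Set ℝ
  isOpen_Θ : IsOpen Θ
  convex_Θ : Convex ℝ Θ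
  b : ℝ → ℝ
  c : ℝ → ℝ
  measurable_c : Measurable c
  φ : ℝ
  φ_pos : 0 < φ
  lintegral_density : ∀ θ ∈ Θ,
    ∫⁻ y, ENNReal.ofReal (Real.exp ((y * θ - b θ) / φ + c y)) ∂ν = 1

attribute [instance] ExpFamily.sigmaFinite

/-- The density `f₀ (y; θ)`. -/
def ExpFamily.density (F : ExpFamily) (y θ : ℝ) : ℝ :=
  Real.exp ((y * θ - F.b θ) / F.φ + F.c y)

/-- The mean function `g⁻¹ = b'` of the canonical link `g`. -/
def ExpFamily.meanFn (F : ExpFamily) : ℝ → ℝ := deriv F.b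

/-- The variance function `b''`, as a function of the linear predictor; this is the derivative
of `g⁻¹`, the quantity that is written `1 / ġ (xᵀ β)`. -/
def ExpFamily.varFn (F : ExpFamily) : ℝ → ℝ := deriv (deriv F.b)

/-- Coefficient and covariate vectors. -/
abbrev Vec (p : ℕ) : Type := EuclideanSpace ℝ (Fin p)

/-- The `ℓ₁` norm. -/
def l1 {p : ℕ} (v : Vec p) : ℝ := ∑ j, |v j|

/-- The action of a matrix on vectors. -/
def act {p : ℕ} (M : Matrix (Fin p) (Fin p) ℝ) (v : Vec p) : Vec p :=
  WithLp.toLp 2 (M *ᵥ v.ofLp)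

/-- `a` is a maximiser of `f` over `D`. -/
def IsArgmax {α : Type*} (f : α → ℝ) (D : Set α) (a : α) : Prop :=
  a ∈ D ∧ IsMaxOn f D a

/-! ### Sample quantities

A dataset is given by covariates `x i`, responses `y i` and the finite set `s` of the indices of
the observations it consists of; its size is `s.card`. -/

section Sample

variable {p : ℕ} (F : ExpFamily) (s : Finset ℕ) (x : ℕ → Vec p) (y : ℕ → ℝ)

/-- The coefficient vectors whose linear predictors are admissible canonical parameters. -/
def paramSet : Set (Vec p) := {β | ∀ i ∈ s, inner ℝ (x i) β ∈ F.Θ}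

/-- The likelihood. -/
def likelihood (β : Vec p) : ℝ := ∏ i ∈ s, F.density (y i) (inner ℝ (x i) β)

/-- The lasso objective: normalised log-likelihood (up to a constant) minus `ℓ₁` penalty. -/
def penLik (lam : ℝ) (β : Vec p) : ℝ :=
  (s.card : ℝ)⁻¹ * ∑ i ∈ s, (y i * inner ℝ (x i) β - F.b (inner ℝ (x i) β)) / F.φ - lam * l1 β

/-- The score `S_n (β)`, with dispersion `ψ`. -/
def score (ψ : ℝ) (β : Vec p) : Vec p :=
  (s.card : ℝ)⁻¹ • ∑ i ∈ s, ((y i - F.meanFn (inner ℝ (x i) β)) / ψ) • x i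

/-- The negative sensitivity matrix `-Ṡ_n (β) = (n ψ)⁻¹ Xᵀ P_n(β) X`, with dispersion `ψ`. -/
def info (ψ : ℝ) (β : Vec p) : Matrix (Fin p) (Fin p) ℝ :=
  (s.card : ℝ)⁻¹ • ∑ i ∈ s,
    (F.varFn (inner ℝ (x i) β) / ψ) • vecMulVec (x i).ofLp (x i).ofLp

/-- The bias-corrected estimator `β + Σ̂_n(β) S_n(β)`, `Σ̂_n(β) = {-Ṡ_n(β)}⁻¹`, computed from an
initial estimate `β`. -/
def biasCorrected (ψ : ℝ) (β : Vec p) : Vec p :=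
  β + act (info F s x ψ β)⁻¹ (score F s x y ψ β)

/-- The confidence density at `γ`: the density of the normal distribution centred at the
bias-corrected estimator with covariance matrix `Σ̂_n(β) / n`. -/
def confDensity (ψ : ℝ) (β γ : Vec p) : ℝ :=
  Real.sqrt (((s.card : ℝ) • info F s x ψ β).det / (2 * Real.pi) ^ p) *
    Real.exp (-((s.card : ℝ) / 2) *
      inner ℝ (γ - biasCorrected F s x y ψ β)
        (act (info F s x ψ β) (γ - biasCorrected F s x y ψ β)))

/-- The `n × p` design matrix. -/
def design : Matrix s (Fin p) ℝ := Matrix.of fun i j => x i j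

/-- `max_{i,j} |X_{ij}|`. -/
def maxAbs : ℝ := ⨆ ij : s × Fin p, |design s x ij.1 ij.2|

/-- The singular values `σ₀ ≥ … ≥ σ_{p-1}` of `n^{-1/2} X`. -/
def singVal (r : ℕ) : ℝ :=
  (Matrix.toEuclideanLin ((Real.sqrt s.card)⁻¹ • design s x)).singularValues r

end Sample

/-! ### Combination over `K` blocks -/

section Combine

variable {p K : ℕ} (F : ExpFamily) (s : Fin K → Finset ℕ) (x : ℕ → Vec p) (y : ℕ → ℝ)

/-- The product of the confidence densities of the blocks `s k`, with initial estimates `β k` and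
dispersions `ψ k`, as a function of the parameter. -/
def prodConfDensity (ψ : Fin K → ℝ) (β : Fin K → Vec p) (γ : Vec p) : ℝ :=
  ∏ k, confDensity F (s k) x y (ψ k) (β k) γ

/-- The information-weighted average of the bias-corrected estimators of the blocks. -/
def weightedAverage (ψ : Fin K → ℝ) (β : Fin K → Vec p) : Vec p :=
  act (∑ k, ((s k).card : ℝ) • info F (s k) x (ψ k) (β k))⁻¹
    (∑ k, ((s k).card : ℝ) •
      act (info F (s k) x (ψ k) (β k)) (biasCorrected F (s k) x y (ψ k) (β k)))

end Combine

/-! ### Probability -/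

section Prob

variable {Ω : Type*} [MeasurableSpace Ω] (P : Measure Ω)

/-- `A m` holds with probability tending to one as `m → ∞`. -/
def WithHighProb (A : ℕ → Ω → Prop) : Prop :=
  Tendsto (fun m => P {ω | ¬ A m ω}) atTop (𝓝 0)

/-- `Z m = O_p(r m)` as `m → ∞`. -/
def IsBigOP (Z : ℕ → Ω → ℝ) (r : ℕ → ℝ) : Prop :=
  ∀ ε : ℝ≥0∞, 0 < ε → ∃ M : ℝ, ∀ᶠ m in atTop, P {ω | M * r m < |Z m ω|} ≤ ε

variable {p : ℕ} (F : ExpFamily) (x : ℕ → Ω → Vec p) (y : ℕ → Ω → ℝ) (β₀ : Vec p)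

/-- The observations `(x i, y i)` are independent and identically distributed, and given the
covariate vector `x i`, the response has density `f₀ (·; x iᵀ β₀)`. -/
structure IsGLMSample : Prop where
  measurable_x : ∀ i, Measurable (x i)
  measurable_y : ∀ i, Measurable (y i)
  indep : iIndepFun (fun i ω => (x i ω, y i ω)) P
  ident : ∀ i, IdentDistrib (fun ω => (x i ω, y i ω)) (fun ω => (x 0 ω, y 0 ω)) P P
  law : P.map (fun ω => (x 0 ω, y 0 ω)) =
    ((P.map (x 0)).prod F.ν).withDensity
      (fun z => ENNReal.ofReal (F.density z.2 (inner ℝ z.1 β₀)))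

/-- The Fisher information `E {b''(x₁ᵀ β₀) x₁ x₁ᵀ / φ}` of one observation. -/
def fisherInfo : Matrix (Fin p) (Fin p) ℝ :=
  Matrix.of fun i j => ∫ ω, info F {0} (fun l => x l ω) F.φ β₀ i j ∂P

/-- Regularity of the model near the true value. `𝒳` is the set of possible covariate vectors. -/
def CondC1 (𝒳 : Set (Vec p)) : Prop :=
  (∀ i, ∀ᵐ ω ∂P, x i ω ∈ 𝒳) ∧
  Integrable (fun ω => ((y 0 ω - F.meanFn (inner ℝ (x 0 ω) β₀)) / F.φ) • x 0 ω) P ∧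
  ∫ ω, ((y 0 ω - F.meanFn (inner ℝ (x 0 ω) β₀)) / F.φ) • x 0 ω ∂P = 0 ∧
  ∃ δ > 0,
    (∀ β, l1 (β - β₀) < δ → ∀ v ∈ 𝒳, inner ℝ v β ∈ F.Θ) ∧
    (∀ β, l1 (β - β₀) < δ → ∃ a > 0, ∃ A : ℝ, ∀ v ∈ 𝒳,
      a ≤ F.varFn (inner ℝ v β) ∧ F.varFn (inner ℝ v β) ≤ A) ∧
    (∃ L : ℝ, ∀ β, l1 (β - β₀) < δ → ∀ v ∈ 𝒳,
      |F.varFn (inner ℝ v β) - F.varFn (inner ℝ v β₀)| ≤ L * |inner ℝ v (β - β₀)|)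

variable {K : ℕ} (n : ℕ → Fin K → ℕ) (s : ℕ → Fin K → Ω → Finset ℕ)

/-- The size of the smallest block. -/
def nMin (m : ℕ) : ℕ := ⨅ k, n m k

/-- The size of the full data. -/
def nTot (m : ℕ) : ℕ := ∑ k, n m k

/-- Block `k` of stage `m` of the partition: the observations `i < N` that are assigned to `k`. -/
def block (part : ℕ → Ω → ℕ → Fin K) (m : ℕ) (k : Fin K) (ω : Ω) : Finset ℕ :=
  (Finset.range (nTot n m)).filter fun i => part m ω i = k

/-- `part m` is a (possibly random) partition of the first `N` observations into blocks of sizes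
`n m k`, drawn independently of the data. -/
structure IsRandomPartition (part : ℕ → Ω → ℕ → Fin K) : Prop where
  measurable : ∀ m, Measurable (part m)
  card_block : ∀ m k ω, (block n part m k ω).card = n m k
  indep : ∀ m, IndepFun (fun ω i => (x i ω, y i ω)) (part m) P

/-- Boundedness of the entries and of the singular values of the block design matrices. -/
def CondC2 : Prop :=
  IsBigOP P (fun m ω => ⨆ k, maxAbs (s m k ω) (fun i => x i ω)) (fun _ => 1) ∧
  ∃ b > 0, ∃ B > 0, WithHighProb P fun m ω => ∀ k,
    b ≤ singVal (s m k ω) (fun i => x i ω) (p - 1) ∧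
    singVal (s m k ω) (fun i => x i ω) 0 ≤ B

/-- The number of non-zero true coefficients. -/
def sparsity : ℕ := (Finset.univ.filter fun j => β₀ j ≠ 0).card

/-- The tuning parameter `(log p / n_k)^{1/2}`. -/
def tuning (p : ℕ) (m : ℕ) (k : Fin K) : ℝ := Real.sqrt (Real.log p / n m k)

/-- Dimension, sparsity, and rates of the block lasso estimators `βLas m k`. -/
def CondC3 (βLas : ℕ → Fin K → Ω → Vec p) : Prop :=
  0 < p ∧ (∀ᶠ m in atTop, p < nMin n m) ∧
  Tendsto (fun m => (sparsity β₀ : ℝ) * Real.log p / Real.sqrt (nMin n m)) atTop (𝓝 0) ∧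
  ∀ k,
    IsBigOP P (fun m ω => l1 (βLas m k ω - β₀))
      (fun m => sparsity β₀ * tuning n p m k) ∧
    IsBigOP P (fun m ω => (n m k : ℝ)⁻¹ *
        ∑ i ∈ s m k ω, (inner ℝ (x i ω) (βLas m k ω - β₀)) ^ 2)
      (fun m => sparsity β₀ * tuning n p m k ^ 2)

/-- `N^{1/2} (β̂ - β₀)` converges in distribution to the centred normal law with covariance
matrix `S`. -/
def IsAsympNormal [IsProbabilityMeasure P] (βhat : ℕ → Ω → Vec p)
    (S : Matrix (Fin p) (Fin p) ℝ) : Prop :=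
  TendstoInDistribution (fun m ω => Real.sqrt (nTot n m) • (βhat m ω - β₀)) atTop
    (id : Vec p → Vec p) (fun _ => P) (multivariateGaussian 0 S)

end Prob

end DivideCombine

end

/-!
The dimension `p` is fixed, so everything happens at the rate `N^{-1/2}`, and both estimators are
shown to solve the same linear equation up to negligible terms. With `J` the Fisher information of
one observation, `Z` the normalised score `N^{-1/2} ∑ (y i - b' (x iᵀ β₀)) x i / φ` of the full data
and `u = N^{1/2} (β̂ - β₀)`, in either case

  `J u = Z + o_p(1) + o_p(1) ‖u‖`.

As `J` is invertible this makes `u` tight, hence `u = J⁻¹ Z + o_p(1)`, and the central limit theorem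
for `J⁻¹ Z` gives the limit `N(0, J⁻¹)` (`isAsympNormal_of_linearisation`).

For the divide-and-combine estimator, the product of the confidence densities is a normal density
centred at the information-weighted average (`isArgmax_prodConfDensity_iff`); it therefore has a
unique maximiser as soon as the block information matrices are positive definite. Each
bias-corrected estimator is one Newton step from the lasso, so, weighted by the information, it
returns the block score at `β₀` up to a quadratic error in the lasso error. The block scores add up
to the score of the full data, however the blocks were chosen
(`norm_linearisation_weightedAverage`). Estimating `φ` multiplies the block scores by factors that
tend to one. This is harmless since each block score is of order `N^{1/2}`, by a second moment
bound that uses that the partition is independent of the data (`isBigOP_scoreSum_block`).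

For the maximum likelihood estimator, concavity of the log-likelihood gives consistency: on a small
sphere around `β₀` the score points inwards, whereas on the segment from `β₀` to the maximiser it
points to the maximiser (`inner_scoreSum_nonneg`, `norm_mle_sub_le`). The estimator then is a zero
of the score, and expanding the score yields the linear equation.

Three facts feed these arguments. Since the maximal entry of the design is bounded in probability
and the covariates are i.i.d., the covariates are almost surely bounded (`exists_norm_le`). The
bound on the singular values excludes that the covariates lie in a hyperplane, so that `J` is
positive definite (`eq_zero_of_ae_inner_eq_zero`). The covariance matrix of the score is `J`,
because `b` is a rescaled cumulant generating function and thus `φ b''` the variance of the response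
(`ExpFamily.lintegral_sq_sub_meanFn`).
-/

noncomputable section

namespace DivideCombine

/-! ### Limits in probability along a filter -/

section Whp

variable {Ω : Type*} [MeasurableSpace Ω]

/-- The filter of the events (families of sets indexed by the stage `m`) whose probability tends
to one. Convergence along this filter to a constant is convergence in probability, so that the
calculus of limits along filters is available for it. No measurability is required. -/
def whp (P : Measure Ω) : Filter (ℕ × Ω) where
  sets := {S | Tendsto (fun m => P {ω | (m, ω) ∉ S}) atTop (𝓝 0)}
  univ_sets := by simp
  sets_of_superset := by
    intro S T hS hST
    refine tendsto_of_tendsto_of_tendsto_of_le_of_le tendsto_const_nhds hS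
      (fun _ => zero_le) (fun m => measure_mono fun ω hω h => hω (hST h))
  inter_sets := by
    intro S T hS hT
    have h := hS.add hT
    rw [add_zero] at h
    refine tendsto_of_tendsto_of_tendsto_of_le_of_le tendsto_const_nhds h
      (fun _ => zero_le) (fun m => le_trans (measure_mono ?_) (measure_union_le _ _))
    intro ω hω
    by_contra hc
    simp only [Set.mem_union, Set.mem_ofPred_eq, not_or, not_not] at hc
    exact hω hc

variable {P : Measure Ω}

lemma eventually_whp {A : ℕ → Ω → Prop} :
    (∀ᶠ z in whp P, A z.1 z.2) ↔ WithHighProb P A := Iff.rfl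

lemma eventually_whp_of_ae {A : ℕ → Ω → Prop} (h : ∀ m, ∀ᵐ ω ∂P, A m ω) :
    ∀ᶠ z in whp P, A z.1 z.2 := by
  have : ∀ m, P {ω | ¬ A m ω} = 0 := fun m => ae_iff.1 (h m)
  change Tendsto (fun m => P {ω | ¬ A m ω}) atTop (𝓝 0)
  simp [this]

lemma tendsto_fst_whp : Tendsto Prod.fst (whp P) atTop := by
  refine tendsto_atTop.2 fun M => ?_
  change Tendsto (fun m => P {ω | ¬ M ≤ m}) atTop (𝓝 0)
  refine tendsto_const_nhds.congr' ?_
  filter_upwards [eventually_ge_atTop M] with m hm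
  simp [hm]

lemma tendstoInMeasure_const_iff {E : Type*} [PseudoMetricSpace E] {f : ℕ → Ω → E} {c : E} :
    TendstoInMeasure P f atTop (fun _ => c) ↔
      Tendsto (fun z : ℕ × Ω => f z.1 z.2) (whp P) (𝓝 c) := by
  rw [tendstoInMeasure_iff_dist, Metric.tendsto_nhds]
  refine forall₂_congr fun ε _ => ?_
  change _ ↔ Tendsto (fun m => P {ω | ¬ dist (f m ω) c < ε}) atTop (𝓝 0)
  simp only [not_lt]

/-- Boundedness in probability, with a positive bound. -/
lemma isBigOP_one_iff {Z : ℕ → Ω → ℝ} : IsBigOP P Z (fun _ => 1) ↔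
    ∀ ε : ℝ≥0∞, 0 < ε → ∃ M : ℝ, 0 < M ∧ ∀ᶠ m in atTop, P {ω | M < |Z m ω|} ≤ ε := by
  constructor
  · intro h ε hε
    obtain ⟨M, hM⟩ := h ε hε
    refine ⟨max M 1, by positivity, hM.mono fun m hm => le_trans (measure_mono ?_) hm⟩
    intro ω hω
    simp only [Set.mem_ofPred_eq, mul_one] at hω ⊢
    exact (le_max_left _ _).trans_lt hω
  · intro h ε hε
    obtain ⟨M, -, hM⟩ := h ε hε
    exact ⟨M, by simpa using hM⟩

lemma IsBigOP.mono {Z W : ℕ → Ω → ℝ} (hW : IsBigOP P W (fun _ => 1))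
    (h : ∀ᶠ z in whp P, |Z z.1 z.2| ≤ |W z.1 z.2|) : IsBigOP P Z (fun _ => 1) := by
  rw [isBigOP_one_iff] at *
  intro ε hε
  obtain ⟨M, hM0, hM⟩ := hW (ε / 2) (ENNReal.half_pos hε.ne')
  have h' : Tendsto (fun m => P {ω | ¬ |Z m ω| ≤ |W m ω|}) atTop (𝓝 0) := h
  refine ⟨M, hM0, ?_⟩
  filter_upwards [hM, (tendsto_order.1 h').2 _ (ENNReal.half_pos hε.ne')] with m h1 h2
  calc P {ω | M < |Z m ω|} ≤ P ({ω | M < |W m ω|} ∪ {ω | ¬ |Z m ω| ≤ |W m ω|}) := by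
        refine measure_mono fun ω hω => ?_
        by_cases hc : |Z m ω| ≤ |W m ω|
        · exact Or.inl (lt_of_lt_of_le hω hc)
        · exact Or.inr hc
    _ ≤ ε / 2 + ε / 2 := (measure_union_le _ _).trans (add_le_add h1 h2.le)
    _ = ε := ENNReal.add_halves ε

lemma IsBigOP.add {Z W : ℕ → Ω → ℝ} (hZ : IsBigOP P Z (fun _ => 1))
    (hW : IsBigOP P W (fun _ => 1)) : IsBigOP P (fun m ω => Z m ω + W m ω) (fun _ => 1) := by
  rw [isBigOP_one_iff] at *
  intro ε hε
  obtain ⟨M, hM0, hM⟩ := hZ (ε / 2) (ENNReal.half_pos hε.ne')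
  obtain ⟨M', hM'0, hM'⟩ := hW (ε / 2) (ENNReal.half_pos hε.ne')
  refine ⟨M + M', by positivity, ?_⟩
  filter_upwards [hM, hM'] with m h1 h2
  calc P {ω | M + M' < |Z m ω + W m ω|} ≤ P ({ω | M < |Z m ω|} ∪ {ω | M' < |W m ω|}) := by
        refine measure_mono fun ω hω => ?_
        by_contra hc
        simp only [Set.mem_union, Set.mem_ofPred_eq, not_or, not_lt] at hc hω
        linarith [abs_add_le (Z m ω) (W m ω), hc.1, hc.2]
    _ ≤ ε / 2 + ε / 2 := (measure_union_le _ _).trans (add_le_add h1 h2)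
    _ = ε := ENNReal.add_halves ε

lemma IsBigOP.const_mul {Z : ℕ → Ω → ℝ} (hZ : IsBigOP P Z (fun _ => 1)) (c : ℝ) :
    IsBigOP P (fun m ω => c * Z m ω) (fun _ => 1) := by
  rw [isBigOP_one_iff] at *
  intro ε hε
  obtain ⟨M, hM0, hM⟩ := hZ ε hε
  refine ⟨(|c| + 1) * M, by positivity, hM.mono fun m hm => le_trans (measure_mono ?_) hm⟩
  intro ω hω
  simp only [Set.mem_ofPred_eq, abs_mul] at hω ⊢
  by_contra hc
  nlinarith [abs_nonneg c, abs_nonneg (Z m ω)]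

lemma isBigOP_of_tendsto_zero {Z : ℕ → Ω → ℝ}
    (h : Tendsto (fun z : ℕ × Ω => Z z.1 z.2) (whp P) (𝓝 0)) : IsBigOP P Z (fun _ => 1) := by
  rw [isBigOP_one_iff]
  intro ε hε
  have h1 := Metric.tendsto_nhds.1 h 1 one_pos
  have h2 : Tendsto (fun m => P {ω | ¬ dist (Z m ω) 0 < 1}) atTop (𝓝 0) := h1
  refine ⟨1, one_pos, ?_⟩
  filter_upwards [(tendsto_order.1 h2).2 _ hε] with m hm
  refine le_trans (measure_mono fun ω hω => ?_) hm.le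
  simp only [Set.mem_ofPred_eq, dist_zero_right, Real.norm_eq_abs, not_lt] at hω ⊢
  exact hω.le

lemma IsBigOP.sum {ι : Type*} (s : Finset ι) {Z : ι → ℕ → Ω → ℝ}
    (h : ∀ i ∈ s, IsBigOP P (Z i) (fun _ => 1)) :
    IsBigOP P (fun m ω => ∑ i ∈ s, Z i m ω) (fun _ => 1) := by
  classical
  induction s using Finset.induction_on with
  | empty => exact isBigOP_of_tendsto_zero (by simpa using tendsto_const_nhds)
  | insert a s ha ih =>
    simp only [Finset.sum_insert ha]
    exact (h a (Finset.mem_insert_self a s)).add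
      (ih fun i hi => h i (Finset.mem_insert_of_mem hi))

/-- `O_p(1) · o_p(1) = o_p(1)`. -/
lemma IsBigOP.mul_tendsto_zero {Z W : ℕ → Ω → ℝ} (hZ : IsBigOP P Z (fun _ => 1))
    (hW : Tendsto (fun z : ℕ × Ω => W z.1 z.2) (whp P) (𝓝 0)) :
    Tendsto (fun z : ℕ × Ω => Z z.1 z.2 * W z.1 z.2) (whp P) (𝓝 0) := by
  rw [isBigOP_one_iff] at hZ
  refine Metric.tendsto_nhds.2 fun η hη => ?_
  change Tendsto (fun m => P {ω | ¬ dist (Z m ω * W m ω) 0 < η}) atTop (𝓝 0)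
  refine ENNReal.tendsto_nhds_zero.2 fun ε hε => ?_
  obtain ⟨M, hM0, hM⟩ := hZ (ε / 2) (ENNReal.half_pos hε.ne')
  have h1 := Metric.tendsto_nhds.1 hW (η / M) (by positivity)
  have h2 : Tendsto (fun m => P {ω | ¬ dist (W m ω) 0 < η / M}) atTop (𝓝 0) := h1
  filter_upwards [hM, (tendsto_order.1 h2).2 _ (ENNReal.half_pos hε.ne')] with m h1 h2
  calc P {ω | ¬ dist (Z m ω * W m ω) 0 < η}
      ≤ P ({ω | M < |Z m ω|} ∪ {ω | ¬ dist (W m ω) 0 < η / M}) := by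
        refine measure_mono fun ω hω => ?_
        by_contra hc
        simp only [Set.mem_union, Set.mem_ofPred_eq, not_or, not_lt, dist_zero_right,
          Real.norm_eq_abs, abs_mul, not_le] at hc hω
        rw [lt_div_iff₀ hM0] at hc
        nlinarith [abs_nonneg (Z m ω), abs_nonneg (W m ω)]
    _ ≤ ε / 2 + ε / 2 := (measure_union_le _ _).trans (add_le_add h1 h2.le)
    _ = ε := ENNReal.add_halves ε

/-- A uniform bound on second moments gives boundedness in probability. -/
lemma isBigOP_of_integral_sq_le [IsProbabilityMeasure P] {Z : ℕ → Ω → ℝ} {C : ℝ}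
    (hint : ∀ m, Integrable (fun ω => Z m ω ^ 2) P) (hC : ∀ m, ∫ ω, Z m ω ^ 2 ∂P ≤ C) :
    IsBigOP P Z (fun _ => 1) := by
  rw [isBigOP_one_iff]
  intro ε hε
  have hC0 : 0 ≤ C := (integral_nonneg fun ω => sq_nonneg _).trans (hC 0)
  obtain ⟨r, hr0, hr⟩ : ∃ r : ℝ, 0 < r ∧ ENNReal.ofReal r ≤ ε := by
    obtain ⟨q, hq0, hq⟩ := ENNReal.lt_iff_exists_nnreal_btwn.1 hε
    exact ⟨q, by exact_mod_cast hq0, by simpa using hq.le⟩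
  refine ⟨Real.sqrt (C / r) + 1, by positivity, .of_forall fun m => ?_⟩
  set M := Real.sqrt (C / r) + 1 with hM
  have hM2 : C / r ≤ M ^ 2 := by
    have := Real.sq_sqrt (show 0 ≤ C / r by positivity)
    nlinarith [Real.sqrt_nonneg (C / r)]
  have hMpos : 0 < M ^ 2 := by positivity
  have h1 := mul_meas_ge_le_integral_of_nonneg (ae_of_all P fun ω => sq_nonneg (Z m ω))
    (hint m) (M ^ 2)
  have h2 : P.real {ω | M ^ 2 ≤ Z m ω ^ 2} ≤ r := by
    have h3 := h1.trans (hC m)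
    rw [div_le_iff₀ hr0] at hM2
    nlinarith
  calc P {ω | M < |Z m ω|} ≤ P {ω | M ^ 2 ≤ Z m ω ^ 2} := by
        refine measure_mono fun ω hω => ?_
        simp only [Set.mem_ofPred_eq] at hω ⊢
        rw [← sq_abs (Z m ω)]
        gcongr
    _ = ENNReal.ofReal (P.real {ω | M ^ 2 ≤ Z m ω ^ 2}) := by simp
    _ ≤ ε := (ENNReal.ofReal_le_ofReal h2).trans hr

/-- A sum of centred, uncorrelated variables with random weights in `[-1, 1]` that do not depend
on them has a second moment of at most the number of summands times the common variance. -/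
lemma integral_sq_weighted_sum_le [IsProbabilityMeasure P] {W a : ℕ → Ω → ℝ} {σ : ℝ}
    (hW : ∀ i, MemLp (W i) 2 P) (hW0 : ∀ i l, i ≠ l → ∫ ω, W i ω * W l ω ∂P = 0)
    (hσ : ∀ i, ∫ ω, W i ω * W i ω ∂P = σ) (ham : ∀ i, Measurable (a i))
    (ha : ∀ i ω, |a i ω| ≤ 1)
    (hind : ∀ i l, IndepFun (fun ω => a i ω * a l ω) (fun ω => W i ω * W l ω) P) (N : ℕ) :
    Integrable (fun ω => (∑ i ∈ Finset.range N, a i ω * W i ω) ^ 2) P ∧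
      ∫ ω, (∑ i ∈ Finset.range N, a i ω * W i ω) ^ 2 ∂P ≤ N * σ := by
  have hprod : ∀ i l, Integrable (fun ω => W i ω * W l ω) P := fun i l =>
    (hW i).integrable_mul (hW l)
  have hle : ∀ i l ω, |a i ω * a l ω| ≤ 1 := fun i l ω => by
    rw [abs_mul]; exact mul_le_one₀ (ha i ω) (abs_nonneg _) (ha l ω)
  have ham2 : ∀ i l, Measurable (fun ω => a i ω * a l ω) := fun i l => (ham i).mul (ham l)
  have hterm : ∀ i l, Integrable (fun ω => (a i ω * a l ω) * (W i ω * W l ω)) P := fun i l =>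
    (hprod i l).bdd_mul (ham2 i l).aestronglyMeasurable
      (ae_of_all _ fun ω => by simpa using hle i l ω)
  have heq : (fun ω => (∑ i ∈ Finset.range N, a i ω * W i ω) ^ 2) = fun ω =>
      ∑ i ∈ Finset.range N, ∑ l ∈ Finset.range N, (a i ω * a l ω) * (W i ω * W l ω) := by
    funext ω
    rw [sq, Finset.sum_mul_sum]
    exact Finset.sum_congr rfl fun i _ => Finset.sum_congr rfl fun l _ => by ring
  rw [heq]
  refine ⟨integrable_finsetSum _ fun i _ => integrable_finsetSum _ fun l _ => hterm i l, ?_⟩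
  rw [integral_finsetSum _ fun i _ => integrable_finsetSum _ fun l _ => hterm i l]
  have hσ0 : 0 ≤ σ := by rw [← hσ 0]; exact integral_nonneg fun ω => mul_self_nonneg _
  have hle2 : ∀ i ∈ Finset.range N,
      ∫ ω, ∑ l ∈ Finset.range N, (a i ω * a l ω) * (W i ω * W l ω) ∂P ≤ σ := by
    intro i hi
    rw [integral_finsetSum _ fun l _ => hterm i l, Finset.sum_eq_single_of_mem i hi]
    · rw [(hind i i).integral_fun_mul_eq_mul_integral (ham2 i i).aestronglyMeasurable
        (hprod i i).aestronglyMeasurable, hσ]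
      have h1 : ∫ ω, a i ω * a i ω ∂P ≤ 1 := by
        calc ∫ ω, a i ω * a i ω ∂P ≤ ∫ _, (1 : ℝ) ∂P := by
              refine integral_mono_of_nonneg (ae_of_all _ fun ω => mul_self_nonneg _)
                (integrable_const _) (ae_of_all _ fun ω => (le_abs_self _).trans (hle i i ω))
          _ = 1 := by simp
      nlinarith
    · intro l _ hl
      rw [(hind i l).integral_fun_mul_eq_mul_integral (ham2 i l).aestronglyMeasurable
        (hprod i l).aestronglyMeasurable, hW0 i l hl.symm, mul_zero]
  calc _ ≤ ∑ _i ∈ Finset.range N, σ := Finset.sum_le_sum hle2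
    _ = N * σ := by simp

end Whp

/-! ### Asymptotic normality of solutions of linearised estimating equations -/

section Normality

variable {Ω : Type*} [MeasurableSpace Ω] {P : Measure Ω} [IsProbabilityMeasure P] {p : ℕ}

lemma measurable_smul_sum_range {X : ℕ → Ω → Vec p} (hX : ∀ i, Measurable (X i)) (c : ℝ) (n : ℕ) :
    Measurable (fun ω => c • ∑ i ∈ Finset.range n, X i ω) :=
  (Finset.measurable_fun_sum _ fun i _ => hX i).const_smul c

/-- The multivariate central limit theorem for centred vectors with covariance matrix `S`, by the
Cramér–Wold device. -/
theorem tendstoInDistribution_multivariateGaussian {X : ℕ → Ω → Vec p}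
    {S : Matrix (Fin p) (Fin p) ℝ} (hS : S.PosSemidef)
    (hX : ∀ i, Measurable (X i)) (hindep : iIndepFun X P)
    (hident : ∀ i, IdentDistrib (X i) (X 0) P P)
    (hL2 : ∀ t, MemLp (fun ω => inner ℝ (X 0 ω) t) 2 P)
    (hmean : ∀ t, ∫ ω, inner ℝ (X 0 ω) t ∂P = 0)
    (hcov : ∀ t, ∫ ω, inner ℝ (X 0 ω) t ^ 2 ∂P = t.ofLp ⬝ᵥ S *ᵥ t.ofLp) :
    TendstoInDistribution (fun (n : ℕ) ω => (Real.sqrt n)⁻¹ • ∑ i ∈ Finset.range n, X i ω) atTop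
      (id : Vec p → Vec p) (fun _ => P) (multivariateGaussian 0 S) where
  forall_aemeasurable n := (measurable_smul_sum_range hX _ n).aemeasurable
  aemeasurable_limit := aemeasurable_id
  tendsto := by
    have hsm : ∀ n : ℕ, Measurable (fun ω => (Real.sqrt n)⁻¹ • ∑ i ∈ Finset.range n, X i ω) :=
      fun n => measurable_smul_sum_range hX _ n
    refine ProbabilityMeasure.tendsto_iff_tendsto_charFun.2 fun t => ?_
    have hm : Measurable (fun v : Vec p => (inner ℝ v t : ℝ)) := by fun_prop
    have hvar : Var[fun ω => inner ℝ (X 0 ω) t; P] = t.ofLp ⬝ᵥ S *ᵥ t.ofLp := by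
      have hm0 : Measurable fun ω => (inner ℝ (X 0 ω) t : ℝ) := hm.comp (hX 0)
      rw [variance_of_integral_eq_zero hm0.aemeasurable (hmean t)]
      exact hcov t
    have hclt := tendstoInDistribution_inv_sqrt_mul_sum_sub (P := P)
      (P' := gaussianReal 0 Var[fun ω => inner ℝ (X 0 ω) t; P].toNNReal)
      (X := fun i ω => inner ℝ (X i ω) t) (Y := id) ⟨aemeasurable_id, by simp⟩ (hL2 t)
      (hindep.comp (fun _ v => inner ℝ v t) fun _ => hm) (fun i => (hident i).comp hm)
    have h1 := ProbabilityMeasure.tendsto_iff_tendsto_charFun.1 hclt.tendsto 1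
    have hnn : 0 ≤ t.ofLp ⬝ᵥ S *ᵥ t.ofLp := by
      rw [← hcov t]; exact integral_nonneg fun _ => sq_nonneg _
    have hlim : charFun (multivariateGaussian 0 S) t =
        charFun (gaussianReal 0 (Var[fun ω => inner ℝ (X 0 ω) t; P]).toNNReal) 1 := by
      rw [charFun_multivariateGaussian hS, charFun_gaussianReal, hvar, Real.coe_toNNReal _ hnn]
      simp
    simp only [ProbabilityMeasure.coe_mk, Measure.map_id] at h1 ⊢
    rw [hlim]
    refine h1.congr fun n => ?_
    rw [charFun_apply_real, charFun_apply, integral_map (hclt.forall_aemeasurable n) (by fun_prop),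
      integral_map (hsm n).aemeasurable (by fun_prop)]
    refine integral_congr_ae (ae_of_all _ fun ω => ?_)
    simp [hmean t, inner_smul_left, sum_inner]

lemma act_eq_toEuclideanLin (M : Matrix (Fin p) (Fin p) ℝ) (v : Vec p) :
    act M v = Matrix.toEuclideanLin M v := rfl

@[simp] lemma act_one (v : Vec p) : act 1 v = v := by simp [act]

lemma act_mul (M N : Matrix (Fin p) (Fin p) ℝ) (v : Vec p) : act (M * N) v = act M (act N v) := by
  simp [act, Matrix.mulVec_mulVec]

lemma act_add (M : Matrix (Fin p) (Fin p) ℝ) (v w : Vec p) : act M (v + w) = act M v + act M w :=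
  map_add (Matrix.toEuclideanLin M) v w

lemma act_sub (M : Matrix (Fin p) (Fin p) ℝ) (v w : Vec p) : act M (v - w) = act M v - act M w :=
  map_sub (Matrix.toEuclideanLin M) v w

lemma act_smul (M : Matrix (Fin p) (Fin p) ℝ) (c : ℝ) (v : Vec p) : act M (c • v) = c • act M v :=
  map_smul (Matrix.toEuclideanLin M) c v

lemma act_finset_sum {ι : Type*} (s : Finset ι) (M : Matrix (Fin p) (Fin p) ℝ) (v : ι → Vec p) :
    act M (∑ i ∈ s, v i) = ∑ i ∈ s, act M (v i) :=
  map_sum (Matrix.toEuclideanLin M) v s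

lemma smul_act (M : Matrix (Fin p) (Fin p) ℝ) (c : ℝ) (v : Vec p) :
    act (c • M) v = c • act M v := by simp [act_eq_toEuclideanLin]

lemma sum_act {ι : Type*} (s : Finset ι) (M : ι → Matrix (Fin p) (Fin p) ℝ) (v : Vec p) :
    act (∑ i ∈ s, M i) v = ∑ i ∈ s, act (M i) v := by simp [act_eq_toEuclideanLin]

lemma sub_act (M N : Matrix (Fin p) (Fin p) ℝ) (v : Vec p) :
    act (M - N) v = act M v - act N v := by simp [act_eq_toEuclideanLin]

lemma measurable_act (M : Matrix (Fin p) (Fin p) ℝ) : Measurable (act M) :=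
  (LinearMap.continuous_of_finiteDimensional (Matrix.toEuclideanLin M)).measurable

lemma inner_eq_dotProduct (v w : Vec p) : inner ℝ v w = v.ofLp ⬝ᵥ w.ofLp := by
  simp [PiLp.inner_apply, dotProduct, mul_comm]

lemma inner_act_eq_dotProduct (M : Matrix (Fin p) (Fin p) ℝ) (v w : Vec p) :
    inner ℝ v (act M w) = v.ofLp ⬝ᵥ M *ᵥ w.ofLp := inner_eq_dotProduct _ _

lemma inner_act_comm {M : Matrix (Fin p) (Fin p) ℝ} (hM : M.IsHermitian) (v w : Vec p) :
    inner ℝ v (act M w) = inner ℝ (act M v) w := by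
  rw [real_inner_comm w (act M v), inner_act_eq_dotProduct, inner_act_eq_dotProduct,
    dotProduct_mulVec, ← mulVec_transpose, dotProduct_comm]
  rw [show Mᵀ = M by simpa using hM.eq]

/-- The sum of the absolute entries bounds the operator norm. -/
lemma norm_act_le (M : Matrix (Fin p) (Fin p) ℝ) (v : Vec p) :
    ‖act M v‖ ≤ (∑ i, ∑ j, |M i j|) * ‖v‖ := by
  calc ‖act M v‖ ≤ ∑ i, |act M v i| := by
        rw [EuclideanSpace.norm_eq]
        refine Real.sqrt_le_iff.2 ⟨Finset.sum_nonneg fun _ _ => abs_nonneg _, ?_⟩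
        simpa using Finset.sum_sq_le_sq_sum_of_nonneg (s := Finset.univ)
          (f := fun i => |act M v i|) fun _ _ => abs_nonneg _
    _ ≤ ∑ i, ∑ j, |M i j| * ‖v‖ := by
        refine Finset.sum_le_sum fun i _ => ?_
        have : act M v i = ∑ j, M i j * v j := by simp [act, mulVec, dotProduct]
        rw [this]
        refine (Finset.abs_sum_le_sum_abs _ _).trans (Finset.sum_le_sum fun j _ => ?_)
        rw [abs_mul]
        exact mul_le_mul_of_nonneg_left (by simpa using PiLp.norm_apply_le v j) (abs_nonneg _)
    _ = _ := by simp [Finset.sum_mul]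

/-- Let `Z` be normalised sums of centred i.i.d. vectors with positive definite covariance matrix
`J`. An estimator whose normalised error `u` satisfies `J u = Z + o_p(1) + o_p(1) u` is
asymptotically normal with covariance matrix `J⁻¹`. -/
theorem isAsympNormal_of_linearisation {X : ℕ → Ω → Vec p} {J : Matrix (Fin p) (Fin p) ℝ}
    (hJ : J.PosDef) (hX : ∀ i, Measurable (X i)) (hindep : iIndepFun X P)
    (hident : ∀ i, IdentDistrib (X i) (X 0) P P)
    (hL2 : ∀ t, MemLp (fun ω => inner ℝ (X 0 ω) t) 2 P)
    (hmean : ∀ t, ∫ ω, inner ℝ (X 0 ω) t ∂P = 0)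
    (hcov : ∀ t, ∫ ω, inner ℝ (X 0 ω) t ^ 2 ∂P = t.ofLp ⬝ᵥ J *ᵥ t.ofLp)
    {K : ℕ} {n : ℕ → Fin K → ℕ} (hN : Tendsto (nTot n) atTop atTop)
    (hZ : IsBigOP P (fun m ω => ‖(Real.sqrt (nTot n m))⁻¹ •
      ∑ i ∈ Finset.range (nTot n m), X i ω‖) (fun _ => 1))
    {β₀ : Vec p} {βhat : ℕ → Ω → Vec p} (hβ : ∀ m, Measurable (βhat m)) {a c : ℕ × Ω → ℝ}
    (ha : Tendsto a (whp P) (𝓝 0)) (hc : Tendsto c (whp P) (𝓝 0))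
    (hlin : ∀ᶠ z in whp P,
      ‖act J (Real.sqrt (nTot n z.1) • (βhat z.1 z.2 - β₀)) - (Real.sqrt (nTot n z.1))⁻¹ •
        ∑ i ∈ Finset.range (nTot n z.1), X i z.2‖
        ≤ a z + c z * ‖Real.sqrt (nTot n z.1) • (βhat z.1 z.2 - β₀)‖) :
    IsBigOP P (fun m ω => ‖Real.sqrt (nTot n m) • (βhat m ω - β₀)‖) (fun _ => 1) ∧
      IsAsympNormal P β₀ n βhat J⁻¹ := by
  set u : ℕ → Ω → Vec p := fun m ω => Real.sqrt (nTot n m) • (βhat m ω - β₀) with hu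
  set Z : ℕ → Ω → Vec p := fun m ω => (Real.sqrt (nTot n m))⁻¹ •
    ∑ i ∈ Finset.range (nTot n m), X i ω with hZdef
  have hdet : IsUnit J.det := hJ.det_pos.ne'.isUnit
  have hinv : ∀ v, act J⁻¹ (act J v) = v := fun v => by
    rw [← act_mul, Matrix.nonsing_inv_mul J hdet, act_one]
  have hinv' : ∀ v, act J (act J⁻¹ v) = v := fun v => by
    rw [← act_mul, Matrix.mul_nonsing_inv J hdet, act_one]
  set κ := ∑ i, ∑ j, |J⁻¹ i j| with hκ
  have hκ0 : 0 ≤ κ := Finset.sum_nonneg fun _ _ => Finset.sum_nonneg fun _ _ => abs_nonneg _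
  have hbd : ∀ v w : Vec p, ‖v - act J⁻¹ w‖ ≤ κ * ‖act J v - w‖ := fun v w => by
    calc ‖v - act J⁻¹ w‖ = ‖act J⁻¹ (act J v - w)‖ := by rw [act_sub, hinv]
      _ ≤ _ := norm_act_le _ _
  have hlin' : ∀ᶠ z in whp P, ‖act J (u z.1 z.2) - Z z.1 z.2‖ ≤ a z + c z * ‖u z.1 z.2‖ := hlin
  -- Absorbing the small multiple of `‖u‖` gives tightness of `u`.
  have hubig : IsBigOP P (fun m ω => ‖u m ω‖) (fun _ => 1) := by
    have haO : IsBigOP P (fun m ω => a (m, ω)) (fun _ => 1) := isBigOP_of_tendsto_zero ha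
    have hdom := (((hZ.add haO).const_mul (2 * κ)))
    have habs : Tendsto (fun z => κ * c z) (whp P) (𝓝 0) := by simpa using hc.const_mul κ
    refine (hdom).mono ?_
    filter_upwards [hlin', habs.eventually_le_const (show (0 : ℝ) < 1 / 2 by norm_num)]
      with z hz hcz
    have h1 := hbd (u z.1 z.2) (Z z.1 z.2)
    have h2 : ‖u z.1 z.2‖ ≤ ‖u z.1 z.2 - act J⁻¹ (Z z.1 z.2)‖ + ‖act J⁻¹ (Z z.1 z.2)‖ := by
      simpa using norm_add_le (u z.1 z.2 - act J⁻¹ (Z z.1 z.2)) (act J⁻¹ (Z z.1 z.2))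
    have h3 : ‖act J⁻¹ (Z z.1 z.2)‖ ≤ κ * ‖Z z.1 z.2‖ := norm_act_le _ _
    have h4 := mul_le_mul_of_nonneg_left hz hκ0
    have h5 := mul_le_mul_of_nonneg_right hcz (norm_nonneg (u z.1 z.2))
    rw [abs_of_nonneg (norm_nonneg _)]
    refine le_trans ?_ (le_abs_self _)
    nlinarith
  refine ⟨hubig, ?_⟩
  have hsymm : ∀ v t : Vec p, inner ℝ (act J⁻¹ v) t = inner ℝ v (act J⁻¹ t) := fun v t =>
    (inner_act_comm hJ.inv.isHermitian v t).symm
  have hclt : TendstoInDistribution (fun (n : ℕ) ω => (Real.sqrt n)⁻¹ •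
      ∑ i ∈ Finset.range n, act J⁻¹ (X i ω)) atTop
      (id : Vec p → Vec p) (fun _ => P) (multivariateGaussian 0 J⁻¹) := by
    refine tendstoInDistribution_multivariateGaussian (X := fun i ω => act J⁻¹ (X i ω))
      hJ.inv.posSemidef (fun i => (measurable_act _).comp (hX i))
      (hindep.comp (fun _ => act J⁻¹) fun _ => measurable_act _)
      (fun i => (hident i).comp (measurable_act _)) (fun t => ?_) (fun t => ?_) (fun t => ?_)
    · simp only [hsymm]; exact hL2 _
    · simp only [hsymm]; exact hmean _
    · simp only [hsymm]
      rw [hcov, ← inner_act_eq_dotProduct, hinv', real_inner_comm, inner_act_eq_dotProduct]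
  have hcltm : TendstoInDistribution (fun m ω => act J⁻¹ (Z m ω)) atTop
      (id : Vec p → Vec p) (fun _ => P) (multivariateGaussian 0 J⁻¹) := by
    refine ⟨fun m => ((measurable_act _).comp
      (measurable_smul_sum_range hX _ _)).aemeasurable,
      aemeasurable_id, ?_⟩
    refine (hclt.tendsto.comp hN).congr fun m => ?_
    refine Subtype.ext ?_
    simp only [Function.comp, hZdef, act_smul, act_finset_sum]
  refine tendstoInDistribution_of_tendstoInMeasure_sub _ _ hcltm ?_
    (fun m => (((hβ m).sub_const β₀).const_smul (Real.sqrt (nTot n m))).aemeasurable)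
  have hsmall : Tendsto (fun z : ℕ × Ω => κ * (a z + ‖u z.1 z.2‖ * c z)) (whp P) (𝓝 0) := by
    have h1 := hubig.mul_tendsto_zero (W := fun m ω => c (m, ω)) hc
    simpa using (ha.add h1).const_mul κ
  refine (tendstoInMeasure_const_iff (c := (0 : Vec p))).2 ?_
  refine squeeze_zero_norm' ?_ hsmall
  filter_upwards [hlin'] with z hz
  have h1 := hbd (u z.1 z.2) (Z z.1 z.2)
  have h4 := mul_le_mul_of_nonneg_left hz hκ0
  simp only [Pi.sub_apply]
  calc _ ≤ _ := h1
    _ ≤ _ := h4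
    _ = _ := by ring

end Normality

/-! ### Exponential families: cumulants and convexity -/

namespace ExpFamily

variable (F : ExpFamily)

/-- The measure with density `exp (c y)` with respect to `ν`. The family consists of its
exponential tilts, and `b θ = φ · cgf (θ / φ)` for its cumulant generating function. -/
def carrier : Measure ℝ := F.ν.withDensity fun y => ENNReal.ofReal (Real.exp (F.c y))

variable {F}

lemma lintegral_mul_density {f : ℝ → ℝ≥0∞} (hf : Measurable f) (θ : ℝ) :
    ∫⁻ y, f y * ENNReal.ofReal (F.density y θ) ∂F.ν =
      ∫⁻ y, f y * ENNReal.ofReal (Real.exp (θ / F.φ * y) / Real.exp (F.b θ / F.φ))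
        ∂F.carrier := by
  have hc := F.measurable_c
  rw [carrier, lintegral_withDensity_eq_lintegral_mul _ (by fun_prop) (by fun_prop)]
  refine lintegral_congr fun y => ?_
  simp only [Pi.mul_apply, density]
  rw [mul_left_comm, ← ENNReal.ofReal_mul (Real.exp_nonneg _), ← Real.exp_sub, ← Real.exp_add]
  congr 3
  ring

lemma lintegral_exp_carrier {θ : ℝ} (hθ : θ ∈ F.Θ) :
    ∫⁻ y, ENNReal.ofReal (Real.exp (θ / F.φ * y)) ∂F.carrier =
      ENNReal.ofReal (Real.exp (F.b θ / F.φ)) := by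
  have h1 := lintegral_mul_density (F := F) (f := fun _ => 1) measurable_const θ
  simp only [one_mul] at h1
  have h2 : ∫⁻ y, ENNReal.ofReal (F.density y θ) ∂F.ν = 1 := F.lintegral_density θ hθ
  rw [h2] at h1
  have h3 : ∀ y, ENNReal.ofReal (Real.exp (θ / F.φ * y)) =
      ENNReal.ofReal (Real.exp (F.b θ / F.φ)) *
        ENNReal.ofReal (Real.exp (θ / F.φ * y) / Real.exp (F.b θ / F.φ)) := fun y => by
    rw [← ENNReal.ofReal_mul (Real.exp_nonneg _), mul_div_cancel₀ _ (Real.exp_ne_zero _)]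
  simp_rw [h3]
  rw [lintegral_const_mul _ (by fun_prop), ← h1, mul_one]

lemma integrable_exp_carrier {θ : ℝ} (hθ : θ ∈ F.Θ) :
    Integrable (fun y => Real.exp (θ / F.φ * y)) F.carrier := by
  refine ⟨by fun_prop, ?_⟩
  rw [hasFiniteIntegral_iff_ofReal (ae_of_all _ fun _ => Real.exp_nonneg _),
    lintegral_exp_carrier hθ]
  exact ENNReal.ofReal_lt_top

lemma mgf_carrier {θ : ℝ} (hθ : θ ∈ F.Θ) :
    mgf id F.carrier (θ / F.φ) = Real.exp (F.b θ / F.φ) := by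
  rw [mgf, integral_eq_lintegral_of_nonneg_ae (ae_of_all _ fun _ => Real.exp_nonneg _)
    (by fun_prop)]
  simp only [id]
  rw [lintegral_exp_carrier hθ, ENNReal.toReal_ofReal (Real.exp_nonneg _)]

lemma b_eq_cgf {θ : ℝ} (hθ : θ ∈ F.Θ) : F.b θ = F.φ * cgf id F.carrier (θ / F.φ) := by
  rw [cgf, mgf_carrier hθ, Real.log_exp, mul_div_cancel₀ _ F.φ_pos.ne']

lemma div_mem_interior {θ : ℝ} (hθ : θ ∈ F.Θ) :
    θ / F.φ ∈ interior (integrableExpSet id F.carrier) := by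
  have hφ := F.φ_pos.ne'
  rw [mem_interior]
  refine ⟨(fun t => F.φ * t) ⁻¹' F.Θ, fun t ht => ?_, F.isOpen_Θ.preimage (by fun_prop), ?_⟩
  · have := integrable_exp_carrier (F := F) ht
    rwa [mul_div_cancel_left₀ _ hφ] at this
  · simpa [mul_div_cancel₀ _ hφ] using hθ

lemma hasDerivAt_b_cgf {θ : ℝ} (hθ : θ ∈ F.Θ) :
    HasDerivAt F.b (deriv (cgf id F.carrier) (θ / F.φ)) θ := by
  have h1 := (analyticAt_cgf (div_mem_interior hθ)).differentiableAt.hasDerivAt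
  have h2 : HasDerivAt (fun t => F.φ * cgf id F.carrier (t / F.φ))
      (F.φ * (deriv (cgf id F.carrier) (θ / F.φ) * (1 / F.φ))) θ := by
    have h := h1.comp θ ((hasDerivAt_id θ).div_const F.φ)
    exact h.const_mul F.φ
  have h3 : F.φ * (deriv (cgf id F.carrier) (θ / F.φ) * (1 / F.φ)) =
      deriv (cgf id F.carrier) (θ / F.φ) := by
    field_simp [F.φ_pos.ne']
  rw [h3] at h2
  refine h2.congr_of_eventuallyEq ?_
  filter_upwards [F.isOpen_Θ.mem_nhds hθ] with t ht using b_eq_cgf ht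

lemma meanFn_eq_cgf {θ : ℝ} (hθ : θ ∈ F.Θ) :
    F.meanFn θ = deriv (cgf id F.carrier) (θ / F.φ) := (hasDerivAt_b_cgf hθ).deriv

lemma hasDerivAt_b {θ : ℝ} (hθ : θ ∈ F.Θ) : HasDerivAt F.b (F.meanFn θ) θ :=
  (hasDerivAt_b_cgf hθ).differentiableAt.hasDerivAt

lemma hasDerivAt_meanFn_cgf {θ : ℝ} (hθ : θ ∈ F.Θ) :
    HasDerivAt F.meanFn (iteratedDeriv 2 (cgf id F.carrier) (θ / F.φ) / F.φ) θ := by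
  have h1 := (analyticAt_cgf (div_mem_interior hθ)).deriv.differentiableAt.hasDerivAt
  have h2 := h1.comp θ ((hasDerivAt_id θ).div_const F.φ)
  rw [iteratedDeriv_succ, iteratedDeriv_one, div_eq_mul_one_div]
  refine h2.congr_of_eventuallyEq ?_
  filter_upwards [F.isOpen_Θ.mem_nhds hθ] with t ht using meanFn_eq_cgf ht

lemma varFn_eq_cgf {θ : ℝ} (hθ : θ ∈ F.Θ) :
    F.varFn θ = iteratedDeriv 2 (cgf id F.carrier) (θ / F.φ) / F.φ :=
  (hasDerivAt_meanFn_cgf hθ).deriv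

lemma hasDerivAt_meanFn {θ : ℝ} (hθ : θ ∈ F.Θ) : HasDerivAt F.meanFn (F.varFn θ) θ :=
  (hasDerivAt_meanFn_cgf hθ).differentiableAt.hasDerivAt

variable (F) in
lemma measurable_meanFn : Measurable F.meanFn := measurable_deriv _

variable (F) in
lemma measurable_varFn : Measurable F.varFn := measurable_deriv _

/-- The variance of the response is `φ b''(θ)`. -/
lemma lintegral_sq_sub_meanFn {θ : ℝ} (hθ : θ ∈ F.Θ) :
    0 ≤ F.varFn θ ∧
    ∫⁻ y, ENNReal.ofReal ((y - F.meanFn θ) ^ 2) * ENNReal.ofReal (F.density y θ) ∂F.ν =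
      ENNReal.ofReal (F.φ * F.varFn θ) := by
  have hint := div_mem_interior hθ
  have hφ := F.φ_pos
  have h1 := iteratedDeriv_two_cgf_eq_integral hint
  rw [← meanFn_eq_cgf hθ, mgf_carrier hθ, ← integral_div] at h1
  have hvar : F.φ * F.varFn θ = iteratedDeriv 2 (cgf id F.carrier) (θ / F.φ) := by
    rw [varFn_eq_cgf hθ, mul_div_cancel₀ _ hφ.ne']
  have hnn : ∀ y : ℝ, 0 ≤ (id y - F.meanFn θ) ^ 2 * Real.exp (θ / F.φ * id y) /
      Real.exp (F.b θ / F.φ) := fun y => by positivity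
  refine ⟨?_, ?_⟩
  · have : 0 ≤ F.φ * F.varFn θ := by
      rw [hvar, h1]; exact integral_nonneg hnn
    exact nonneg_of_mul_nonneg_right this hφ
  rw [lintegral_mul_density (by fun_prop), hvar, h1, ofReal_integral_eq_lintegral_ofReal _
    (ae_of_all _ hnn)]
  · refine lintegral_congr fun y => ?_
    rw [← ENNReal.ofReal_mul (sq_nonneg _), id, mul_div_assoc]
  · have hk : ∀ k : ℕ, Integrable (fun y : ℝ => y ^ k * Real.exp (θ / F.φ * y)) F.carrier :=
      fun k => integrable_pow_mul_exp_of_mem_interior_integrableExpSet hint k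
    have := ((hk 2).sub ((hk 1).const_mul (2 * F.meanFn θ))).add
      ((hk 0).const_mul (F.meanFn θ ^ 2))
    refine (this.div_const (Real.exp (F.b θ / F.φ))).congr (ae_of_all _ fun y => ?_)
    simp only [Pi.add_apply, Pi.sub_apply, id]
    ring

lemma convexOn_b : ConvexOn ℝ F.Θ F.b := by
  have hint : interior F.Θ = F.Θ := F.isOpen_Θ.interior_eq
  refine convexOn_of_deriv2_nonneg F.convex_Θ
    (fun θ hθ => (hasDerivAt_b hθ).continuousAt.continuousWithinAt) ?_ ?_ ?_
  · exact fun θ hθ => (hasDerivAt_b (interior_subset hθ)).differentiableAt.differentiableWithinAt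
  · exact fun θ hθ =>
      (hasDerivAt_meanFn (interior_subset hθ)).differentiableAt.differentiableWithinAt
  · exact fun θ hθ => (lintegral_sq_sub_meanFn (interior_subset hθ)).1

/-- The tangent at `θ` lies below the cumulant function. -/
lemma tangent_le_b {θ η : ℝ} (hθ : θ ∈ F.Θ) (hη : η ∈ F.Θ) :
    F.b θ + F.meanFn θ * (η - θ) ≤ F.b η := by
  have hc := F.convexOn_b
  rcases lt_trichotomy θ η with h | h | h
  · have h1 := hc.le_slope_of_hasDerivAt hθ hη h (hasDerivAt_b hθ)
    rw [slope_def_field, le_div_iff₀ (by linarith)] at h1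
    linarith
  · subst h; simp
  · have h1 := hc.slope_le_of_hasDerivAt hη hθ h (hasDerivAt_b hθ)
    rw [slope_def_field, div_le_iff₀ (by linarith)] at h1
    linarith

end ExpFamily

/-! ### Local expansion of the score and combination of the blocks -/

section Deterministic

variable {p : ℕ}

lemma norm_le_l1 (v : Vec p) : ‖v‖ ≤ l1 v := by
  rw [EuclideanSpace.norm_eq]
  refine Real.sqrt_le_iff.2 ⟨Finset.sum_nonneg fun _ _ => abs_nonneg _, ?_⟩
  simpa [l1] using Finset.sum_sq_le_sq_sum_of_nonneg (s := Finset.univ)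
    (f := fun i => |v i|) fun _ _ => abs_nonneg _

lemma l1_le_norm (v : Vec p) : l1 v ≤ p * ‖v‖ := by
  calc l1 v ≤ ∑ _j : Fin p, ‖v‖ :=
        Finset.sum_le_sum fun j _ => by simpa using PiLp.norm_apply_le v j
    _ = p * ‖v‖ := by simp

lemma l1_smul (c : ℝ) (v : Vec p) : l1 (c • v) = |c| * l1 v := by
  simp [l1, abs_mul, Finset.mul_sum]

/-- The regularity of the model near `β₀` with explicit constants, for covariate vectors in `V`;
in contrast to `CondC1`, these are bounded. -/
structure IsRegularOn (F : ExpFamily) (β₀ : Vec p) (V : Set (Vec p)) (δ L A M : ℝ) : Prop where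
  δ_pos : 0 < δ
  L_nonneg : 0 ≤ L
  A_nonneg : 0 ≤ A
  M_nonneg : 0 ≤ M
  mem_Θ : ∀ β, l1 (β - β₀) < δ → ∀ v ∈ V, inner ℝ v β ∈ F.Θ
  varFn_pos : ∀ β, l1 (β - β₀) < δ → ∀ v ∈ V, 0 < F.varFn (inner ℝ v β)
  varFn_lip : ∀ β, l1 (β - β₀) < δ → ∀ v ∈ V,
    |F.varFn (inner ℝ v β) - F.varFn (inner ℝ v β₀)| ≤ L * |inner ℝ v (β - β₀)|
  varFn_le : ∀ v ∈ V, F.varFn (inner ℝ v β₀) ≤ A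
  norm_le : ∀ v ∈ V, ‖v‖ ≤ M

/-- The score of the data, not normalised by their number. -/
def scoreSum (F : ExpFamily) (s : Finset ℕ) (x : ℕ → Vec p) (y : ℕ → ℝ) (β : Vec p) : Vec p :=
  ∑ i ∈ s, ((y i - F.meanFn (inner ℝ (x i) β)) / F.φ) • x i

/-- The negative sensitivity matrix of the data, not normalised by their number, applied to `v`. -/
def infoSum (F : ExpFamily) (s : Finset ℕ) (x : ℕ → Vec p) (β v : Vec p) : Vec p :=
  ∑ i ∈ s, (F.varFn (inner ℝ (x i) β) / F.φ * inner ℝ (x i) v) • x i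

lemma act_vecMulVec (u v : Vec p) : act (vecMulVec u.ofLp u.ofLp) v = (inner ℝ u v : ℝ) • u := by
  ext j
  simp [act, mulVec, dotProduct, vecMulVec_apply, PiLp.inner_apply, mul_comm, Finset.mul_sum,
    mul_assoc]

lemma act_info (F : ExpFamily) (s : Finset ℕ) (x : ℕ → Vec p) (ψ : ℝ) (β v : Vec p) :
    act (info F s x ψ β) v =
      (s.card : ℝ)⁻¹ • ∑ i ∈ s, (F.varFn (inner ℝ (x i) β) / ψ * inner ℝ (x i) v) • x i := by
  rw [info, smul_act, sum_act]
  simp_rw [smul_act, act_vecMulVec, smul_smul]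

lemma card_smul_act_info (F : ExpFamily) (s : Finset ℕ) (x : ℕ → Vec p) (ψ : ℝ) (β v : Vec p) :
    (s.card : ℝ) • act (info F s x ψ β) v = (F.φ / ψ) • infoSum F s x β v := by
  have hφ := F.φ_pos.ne'
  rcases s.eq_empty_or_nonempty with rfl | hs
  · simp [infoSum]
  rw [act_info, smul_inv_smul₀ (by simpa using hs.ne_empty), infoSum, Finset.smul_sum]
  refine Finset.sum_congr rfl fun i _ => ?_
  rw [smul_smul]
  congr 1
  field_simp

lemma card_smul_score (F : ExpFamily) (s : Finset ℕ) (x : ℕ → Vec p) (y : ℕ → ℝ) (ψ : ℝ)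
    (β : Vec p) : (s.card : ℝ) • score F s x y ψ β = (F.φ / ψ) • scoreSum F s x y β := by
  have hφ := F.φ_pos.ne'
  rcases s.eq_empty_or_nonempty with rfl | hs
  · simp [scoreSum]
  rw [score, smul_inv_smul₀ (by simpa using hs.ne_empty), scoreSum, Finset.smul_sum]
  refine Finset.sum_congr rfl fun i _ => ?_
  rw [smul_smul]
  congr 1
  field_simp

lemma norm_sum_smul_le {s : Finset ℕ} {x : ℕ → Vec p} {M B : ℝ} (hx : ∀ i ∈ s, ‖x i‖ ≤ M)
    {c : ℕ → ℝ} (hc : ∀ i ∈ s, |c i| ≤ B) (hB : 0 ≤ B) :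
    ‖∑ i ∈ s, c i • x i‖ ≤ s.card * (B * M) := by
  refine (norm_sum_le _ _).trans ?_
  calc _ ≤ ∑ _i ∈ s, B * M := Finset.sum_le_sum fun i hi => by
        rw [norm_smul, Real.norm_eq_abs]
        exact mul_le_mul (hc i hi) (hx i hi) (norm_nonneg _) hB
    _ = _ := by simp

namespace IsRegularOn

variable {F : ExpFamily} {β₀ : Vec p} {V : Set (Vec p)} {δ L A M : ℝ}

lemma abs_inner_le (h : IsRegularOn F β₀ V δ L A M) {v : Vec p} (hv : v ∈ V) (u : Vec p) :
    |(inner ℝ v u : ℝ)| ≤ M * ‖u‖ :=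
  (abs_real_inner_le_norm v u).trans
    (mul_le_mul_of_nonneg_right (h.norm_le v hv) (norm_nonneg u))

/-- First order expansion of the mean function at the true linear predictor. -/
lemma abs_meanFn_sub_le (h : IsRegularOn F β₀ V δ L A M) {β : Vec p} (hβ : l1 (β - β₀) < δ)
    {v : Vec p} (hv : v ∈ V) :
    |F.meanFn (inner ℝ v β) - F.meanFn (inner ℝ v β₀)
      - F.varFn (inner ℝ v β₀) * inner ℝ v (β - β₀)| ≤ L * (inner ℝ v (β - β₀)) ^ 2 := by
  set t : ℝ := inner ℝ v (β - β₀) with ht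
  have hseg : ∀ r ∈ Set.Icc (0 : ℝ) 1, l1 (β₀ + r • (β - β₀) - β₀) < δ := fun r hr => by
    rw [add_sub_cancel_left, l1_smul, abs_of_nonneg hr.1]
    have h0 : 0 ≤ l1 (β - β₀) := Finset.sum_nonneg fun _ _ => abs_nonneg _
    nlinarith [hr.2]
  have hin : ∀ r : ℝ, (inner ℝ v (β₀ + r • (β - β₀)) : ℝ) = inner ℝ v β₀ + r * t := fun r => by
    rw [inner_add_right, inner_smul_right]
  have hd : ∀ r ∈ Set.Icc (0 : ℝ) 1,
      HasDerivAt (fun r => F.meanFn (inner ℝ v β₀ + r * t))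
        (F.varFn (inner ℝ v β₀ + r * t) * t) r := fun r hr => by
    have hΘ := h.mem_Θ _ (hseg r hr) v hv
    rw [hin] at hΘ
    have h1 : HasDerivAt (fun r : ℝ => inner ℝ v β₀ + r * t) t r := by
      simpa using ((hasDerivAt_id r).mul_const t).const_add (inner ℝ v β₀)
    exact (F.hasDerivAt_meanFn hΘ).comp r h1
  obtain ⟨r, hr, hr'⟩ := exists_hasDerivAt_eq_slope (fun r => F.meanFn (inner ℝ v β₀ + r * t))
    (fun r => F.varFn (inner ℝ v β₀ + r * t) * t) zero_lt_one
    (fun r hr => (hd r hr).continuousAt.continuousWithinAt)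
    (fun r hr => hd r (Set.Ioo_subset_Icc_self hr))
  have hβeq : (inner ℝ v β : ℝ) = inner ℝ v β₀ + t := by rw [ht, inner_sub_right]; ring
  simp only [one_mul, zero_mul, add_zero, sub_zero, div_one] at hr'
  rw [hβeq, ← hr', ← sub_mul, abs_mul]
  have hl := h.varFn_lip _ (hseg r (Set.Ioo_subset_Icc_self hr)) v hv
  rw [hin, add_sub_cancel_left, inner_smul_right, ← ht, abs_mul, abs_of_pos hr.1] at hl
  rw [← sq_abs t]
  have hL := h.L_nonneg
  have h2 : L * (r * |t|) ≤ L * |t| :=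
    mul_le_mul_of_nonneg_left (by nlinarith [hr.2, abs_nonneg t]) hL
  nlinarith [abs_nonneg t]

variable {s : Finset ℕ} {x : ℕ → Vec p} {y : ℕ → ℝ}

lemma norm_infoSum_le (h : IsRegularOn F β₀ V δ L A M) (hx : ∀ i ∈ s, x i ∈ V) (v : Vec p) :
    ‖infoSum F s x β₀ v‖ ≤ s.card * (A * M ^ 2 / F.φ * ‖v‖) := by
  have hφ := F.φ_pos
  have hA := h.A_nonneg
  have hM := h.M_nonneg
  refine (norm_sum_smul_le (B := A / F.φ * (M * ‖v‖)) (fun i hi => h.norm_le _ (hx i hi))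
    (fun i hi => ?_) (by positivity)).trans_eq (by ring)
  rw [abs_mul]
  refine mul_le_mul ?_ (h.abs_inner_le (hx i hi) v) (abs_nonneg _) (by positivity)
  rw [abs_div, abs_of_pos hφ, abs_of_pos (h.varFn_pos β₀ (by simpa [l1] using h.δ_pos) _ (hx i hi))]
  gcongr
  exact h.varFn_le _ (hx i hi)

lemma norm_infoSum_sub_le (h : IsRegularOn F β₀ V δ L A M) (hx : ∀ i ∈ s, x i ∈ V)
    {β : Vec p} (hβ : l1 (β - β₀) < δ) (v : Vec p) :
    ‖infoSum F s x β v - infoSum F s x β₀ v‖ ≤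
      s.card * (L * M ^ 3 / F.φ * ‖β - β₀‖ * ‖v‖) := by
  have hφ := F.φ_pos
  have hL := h.L_nonneg
  have hM := h.M_nonneg
  rw [infoSum, infoSum, ← Finset.sum_sub_distrib]
  simp_rw [← sub_smul, ← sub_mul, ← sub_div]
  refine (norm_sum_smul_le (B := L * (M * ‖β - β₀‖) / F.φ * (M * ‖v‖))
    (fun i hi => h.norm_le _ (hx i hi)) (fun i hi => ?_) (by positivity)).trans_eq (by ring)
  rw [abs_mul]
  refine mul_le_mul ?_ (h.abs_inner_le (hx i hi) v) (abs_nonneg _) (by positivity)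
  rw [abs_div, abs_of_pos hφ]
  gcongr
  exact (h.varFn_lip _ hβ _ (hx i hi)).trans
    (mul_le_mul_of_nonneg_left (h.abs_inner_le (hx i hi) _) hL)

/-- First order expansion of the score at the true value. -/
lemma norm_scoreSum_sub_le (h : IsRegularOn F β₀ V δ L A M) (hx : ∀ i ∈ s, x i ∈ V)
    {β : Vec p} (hβ : l1 (β - β₀) < δ) :
    ‖scoreSum F s x y β - scoreSum F s x y β₀ + infoSum F s x β₀ (β - β₀)‖ ≤
      s.card * (L * M ^ 3 / F.φ * ‖β - β₀‖ ^ 2) := by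
  have hφ := F.φ_pos
  have hL := h.L_nonneg
  have hM := h.M_nonneg
  rw [scoreSum, scoreSum, infoSum, ← Finset.sum_sub_distrib, ← Finset.sum_add_distrib]
  simp_rw [← sub_smul, ← add_smul]
  refine (norm_sum_smul_le (B := L * (M * ‖β - β₀‖) ^ 2 / F.φ)
    (fun i hi => h.norm_le _ (hx i hi)) (fun i hi => ?_) (by positivity)).trans_eq (by ring)
  have h1 := h.abs_meanFn_sub_le hβ (hx i hi)
  have h2 : (inner ℝ (x i) (β - β₀) : ℝ) ^ 2 ≤ (M * ‖β - β₀‖) ^ 2 := by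
    rw [← sq_abs]
    exact pow_le_pow_left₀ (abs_nonneg _) (h.abs_inner_le (hx i hi) _) 2
  rw [show (y i - F.meanFn (inner ℝ (x i) β)) / F.φ - (y i - F.meanFn (inner ℝ (x i) β₀)) / F.φ +
      F.varFn (inner ℝ (x i) β₀) / F.φ * inner ℝ (x i) (β - β₀) =
      -(F.meanFn (inner ℝ (x i) β) - F.meanFn (inner ℝ (x i) β₀)
      - F.varFn (inner ℝ (x i) β₀) * inner ℝ (x i) (β - β₀)) / F.φ by ring,
    abs_div, abs_of_pos hφ, abs_neg]
  gcongr
  exact h1.trans (mul_le_mul_of_nonneg_left h2 hL)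

/-- One Newton step from `β` reaches the solution of the score equation that is linearised at the
true value, up to a quadratic error. -/
lemma norm_newton_sub_le (h : IsRegularOn F β₀ V δ L A M) (hx : ∀ i ∈ s, x i ∈ V)
    {β : Vec p} (hβ : l1 (β - β₀) < δ) :
    ‖infoSum F s x β (β - β₀) + scoreSum F s x y β - scoreSum F s x y β₀‖ ≤
      s.card * (2 * (L * M ^ 3 / F.φ) * ‖β - β₀‖ ^ 2) := by
  have h1 := h.norm_infoSum_sub_le hx hβ (β - β₀)
  have h2 := h.norm_scoreSum_sub_le (y := y) hx hβ
  calc _ = ‖(infoSum F s x β (β - β₀) - infoSum F s x β₀ (β - β₀)) +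
        (scoreSum F s x y β - scoreSum F s x y β₀ + infoSum F s x β₀ (β - β₀))‖ := by
        congr 1; abel
    _ ≤ _ := (norm_add_le _ _).trans (add_le_add h1 h2)
    _ = _ := by ring

end IsRegularOn

lemma info_isHermitian (F : ExpFamily) (s : Finset ℕ) (x : ℕ → Vec p) (ψ : ℝ) (β : Vec p) :
    (info F s x ψ β).IsHermitian := by
  ext i j
  simp [info, Matrix.sum_apply, vecMulVec_apply, mul_comm]

lemma inner_act_info (F : ExpFamily) (s : Finset ℕ) (x : ℕ → Vec p) (ψ : ℝ) (β v : Vec p) :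
    inner ℝ v (act (info F s x ψ β) v) =
      (s.card : ℝ)⁻¹ * ∑ i ∈ s, F.varFn (inner ℝ (x i) β) / ψ * (inner ℝ (x i) v) ^ 2 := by
  rw [act_info, inner_smul_right, inner_sum]
  congr 1
  refine Finset.sum_congr rfl fun i _ => ?_
  rw [inner_smul_right, real_inner_comm (x i) v]
  ring

/-- If the smallest singular value of the design matrix is positive, then the design matrix has
trivial kernel. -/
lemma eq_zero_of_singVal_pos {s : Finset ℕ} {x : ℕ → Vec p} (hp : 0 < p)
    (h : 0 < singVal s x (p - 1)) {v : Vec p} (hv : ∀ i ∈ s, (inner ℝ (x i) v : ℝ) = 0) :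
    v = 0 := by
  set T := Matrix.toEuclideanLin ((Real.sqrt s.card)⁻¹ • design s x) with hT
  have h1 : p - 1 < Module.finrank ℝ T.range :=
    (LinearMap.singularValues_pos_iff_lt_finrank_range T).1 h
  have h2 := T.finrank_range_add_finrank_ker
  rw [finrank_euclideanSpace_fin] at h2
  have h3 : Module.finrank ℝ T.ker = 0 := by omega
  have h4 : T.ker = ⊥ := Submodule.finrank_eq_zero.1 h3
  have h5 : v ∈ T.ker := by
    rw [LinearMap.mem_ker]
    ext i
    have := hv i i.2
    rw [inner_eq_dotProduct] at this
    simp only [hT, Matrix.toLpLin_apply, smul_mulVec, Pi.smul_apply, PiLp.zero_apply]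
    rw [show (design s x *ᵥ v.ofLp) i = 0 from this, smul_zero]
  rw [h4] at h5
  exact h5

lemma info_posDef {F : ExpFamily} {s : Finset ℕ} {x : ℕ → Vec p} (hp : 0 < p)
    (h : 0 < singVal s x (p - 1)) {ψ : ℝ} (hψ : 0 < ψ) {β : Vec p}
    (hvar : ∀ i ∈ s, 0 < F.varFn (inner ℝ (x i) β)) : (info F s x ψ β).PosDef := by
  have key : ∀ v : Vec p, v ≠ 0 → 0 < (inner ℝ v (act (info F s x ψ β) v) : ℝ) := fun v hv => by
    rw [inner_act_info]
    obtain ⟨i, hi, hiv⟩ : ∃ i ∈ s, (inner ℝ (x i) v : ℝ) ≠ 0 := by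
      by_contra hc
      push Not at hc
      exact hv (eq_zero_of_singVal_pos hp h hc)
    have hcard : (0 : ℝ) < s.card := by exact_mod_cast Finset.card_pos.2 ⟨i, hi⟩
    refine mul_pos (inv_pos.2 hcard) (Finset.sum_pos' (fun l hl => ?_) ⟨i, hi, ?_⟩)
    · have := hvar l hl
      positivity
    · have := hvar i hi
      positivity
  refine Matrix.PosDef.of_dotProduct_mulVec_pos (info_isHermitian F s x ψ β) fun v hv => ?_
  have := key (WithLp.toLp 2 v) (by simpa using hv)
  rwa [inner_act_eq_dotProduct] at this

section Combination

variable {K : ℕ}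

/-- A weighted sum of quadratic forms with different centres is a quadratic form around the
weighted average of the centres. -/
lemma sum_quadratic_eq {ι : Type*} [Fintype ι] {I : ι → Matrix (Fin p) (Fin p) ℝ}
    (hI : ∀ k, (I k).IsHermitian)
    (hH : IsUnit (∑ k, I k).det) (c : ι → Vec p) (γ : Vec p) :
    ∑ k, (inner ℝ (γ - c k) (act (I k) (γ - c k)) : ℝ) =
      inner ℝ (γ - act (∑ k, I k)⁻¹ (∑ k, act (I k) (c k)))
        (act (∑ k, I k) (γ - act (∑ k, I k)⁻¹ (∑ k, act (I k) (c k)))) +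
      ∑ k, inner ℝ (act (∑ k, I k)⁻¹ (∑ k, act (I k) (c k)) - c k)
        (act (I k) (act (∑ k, I k)⁻¹ (∑ k, act (I k) (c k)) - c k)) := by
  set w := act (∑ k, I k)⁻¹ (∑ k, act (I k) (c k)) with hw
  have hHw : act (∑ k, I k) w = ∑ k, act (I k) (c k) := by
    rw [hw, ← act_mul, Matrix.mul_nonsing_inv _ hH, act_one]
  have hcross : ∑ k, (inner ℝ (γ - w) (act (I k) (w - c k)) : ℝ) = 0 := by
    rw [← inner_sum]
    simp_rw [act_sub]
    rw [Finset.sum_sub_distrib, ← hHw, ← sum_act, sub_self, inner_zero_right]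
  have hexp : ∀ k, (inner ℝ (γ - c k) (act (I k) (γ - c k)) : ℝ) =
      inner ℝ (γ - w) (act (I k) (γ - w)) + 2 * inner ℝ (γ - w) (act (I k) (w - c k)) +
        inner ℝ (w - c k) (act (I k) (w - c k)) := fun k => by
    rw [show γ - c k = (γ - w) + (w - c k) by abel, act_add, inner_add_left, inner_add_right,
      inner_add_right, inner_act_comm (hI k) (w - c k) (γ - w),
      real_inner_comm (γ - w) (act (I k) (w - c k))]
    ring
  simp_rw [hexp]
  rw [Finset.sum_add_distrib, Finset.sum_add_distrib, ← Finset.mul_sum, hcross, mul_zero, add_zero,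
    sum_act, inner_sum]

variable {F : ExpFamily} {s : Fin K → Finset ℕ} {x : ℕ → Vec p} {y : ℕ → ℝ} {ψ : Fin K → ℝ}
  {β : Fin K → Vec p}

lemma sum_info_posDef (hK : 0 < K) (hs : ∀ k, 0 < (s k).card)
    (hI : ∀ k, (info F (s k) x (ψ k) (β k)).PosDef) :
    (∑ k, ((s k).card : ℝ) • info F (s k) x (ψ k) (β k)).PosDef := by
  have : Nonempty (Fin K) := ⟨⟨0, hK⟩⟩
  refine Matrix.posDef_sum Finset.univ_nonempty fun k _ => ?_
  exact (hI k).smul (by exact_mod_cast hs k)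

/-- The product of the confidence densities is proportional to a normal density centred at the
information-weighted average. -/
theorem isArgmax_prodConfDensity_iff (hK : 0 < K) (hs : ∀ k, 0 < (s k).card)
    (hI : ∀ k, (info F (s k) x (ψ k) (β k)).PosDef) (γ : Vec p) :
    IsArgmax (prodConfDensity F s x y ψ β) Set.univ γ ↔ γ = weightedAverage F s x y ψ β := by
  set H := ∑ k, ((s k).card : ℝ) • info F (s k) x (ψ k) (β k) with hHdef
  have hH : H.PosDef := sum_info_posDef hK hs hI
  set w := weightedAverage F s x y ψ β with hw
  have hwdef : w = act H⁻¹ (∑ k, act (((s k).card : ℝ) • info F (s k) x (ψ k) (β k))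
      (biasCorrected F (s k) x y (ψ k) (β k))) := by
    simp_rw [smul_act]
    rfl
  set C := ∏ k, Real.sqrt ((((s k).card : ℝ) • info F (s k) x (ψ k) (β k)).det /
    (2 * Real.pi) ^ p) with hC
  have hCpos : 0 < C := by
    refine Finset.prod_pos fun k _ => Real.sqrt_pos.2 (div_pos ?_ (by positivity))
    exact ((hI k).smul (show (0 : ℝ) < (s k).card by exact_mod_cast hs k)).det_pos
  set R := ∑ k, (inner ℝ (w - biasCorrected F (s k) x y (ψ k) (β k))
    (act (((s k).card : ℝ) • info F (s k) x (ψ k) (β k))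
      (w - biasCorrected F (s k) x y (ψ k) (β k))) : ℝ) with hR
  have hval : ∀ γ, prodConfDensity F s x y ψ β γ =
      C * Real.exp (-(1 / 2) * (inner ℝ (γ - w) (act H (γ - w)) + R)) := fun γ => by
    have hq := sum_quadratic_eq (I := fun k => ((s k).card : ℝ) • info F (s k) x (ψ k) (β k))
      (fun k => ((hI k).smul (show (0 : ℝ) < (s k).card by exact_mod_cast hs k)).isHermitian)
      hH.det_pos.ne'.isUnit (fun k => biasCorrected F (s k) x y (ψ k) (β k)) γ
    rw [← hHdef, ← hwdef] at hq
    rw [← hq, prodConfDensity, hC, Finset.mul_sum, Real.exp_sum, ← Finset.prod_mul_distrib]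
    refine Finset.prod_congr rfl fun k _ => ?_
    rw [confDensity, smul_act, inner_smul_right]
    congr 2
    ring
  have hpos : ∀ γ, γ ≠ w → 0 < (inner ℝ (γ - w) (act H (γ - w)) : ℝ) := fun γ hγ => by
    have := hH.dotProduct_mulVec_pos (x := (γ - w).ofLp)
      (by rw [ne_eq, WithLp.ofLp_eq_zero]; exact sub_ne_zero.2 hγ)
    rw [inner_act_eq_dotProduct]
    simpa using this
  have hlt : ∀ γ, γ ≠ w → prodConfDensity F s x y ψ β γ < prodConfDensity F s x y ψ β w := by
    intro γ hγ
    rw [hval, hval, sub_self, inner_zero_left, zero_add]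
    refine mul_lt_mul_of_pos_left (Real.exp_lt_exp.2 ?_) hCpos
    nlinarith [hpos γ hγ]
  constructor
  · rintro ⟨-, hmax⟩
    by_contra hne
    exact absurd (hmax (Set.mem_univ w)) (not_le.2 (hlt γ hne))
  · rintro rfl
    refine ⟨Set.mem_univ _, fun γ _ => ?_⟩
    by_cases hγ : γ = w
    · subst hγ; exact le_refl (prodConfDensity F s x y ψ β _)
    · exact (hlt γ hγ).le

/-- The combined estimating equation: the weighted average collects the Newton steps of the
blocks. -/
lemma act_sum_info_weightedAverage_sub (hK : 0 < K) (hs : ∀ k, 0 < (s k).card)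
    (hI : ∀ k, (info F (s k) x (ψ k) (β k)).PosDef) (β₀ : Vec p) :
    act (∑ k, ((s k).card : ℝ) • info F (s k) x (ψ k) (β k))
        (weightedAverage F s x y ψ β - β₀) =
      ∑ k, (F.φ / ψ k) •
        (infoSum F (s k) x (β k) (β k - β₀) + scoreSum F (s k) x y (β k)) := by
  have hH := sum_info_posDef hK hs hI
  rw [act_sub, weightedAverage, ← act_mul, Matrix.mul_nonsing_inv _ hH.det_pos.ne'.isUnit, act_one,
    sum_act, ← Finset.sum_sub_distrib]
  refine Finset.sum_congr rfl fun k _ => ?_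
  rw [smul_act, ← smul_sub, ← act_sub, biasCorrected, add_sub_right_comm, act_add, ← act_mul,
    Matrix.mul_nonsing_inv _ (hI k).det_pos.ne'.isUnit, act_one, smul_add, card_smul_act_info,
    card_smul_score, ← smul_add]

end Combination

end Deterministic

/-! ### Moments, Fisher information and laws of large numbers -/

section Moments

variable {Ω : Type*} [MeasurableSpace Ω] {P : Measure Ω} {p : ℕ} {F : ExpFamily} {β₀ : Vec p}
  {x : ℕ → Ω → Vec p} {y : ℕ → Ω → ℝ}

lemma measurable_inner_const (β : Vec p) : Measurable (fun v : Vec p => (inner ℝ v β : ℝ)) := by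
  fun_prop

/-- The score of a single observation with covariate vector `z.1` and response `z.2`. -/
def unitScore (F : ExpFamily) (β₀ : Vec p) (z : Vec p × ℝ) : Vec p :=
  ((z.2 - F.meanFn (inner ℝ z.1 β₀)) / F.φ) • z.1

lemma measurable_unitScore : Measurable (unitScore F β₀) := by
  have h1 : Measurable fun z : Vec p × ℝ => F.meanFn (inner ℝ z.1 β₀) :=
    F.measurable_meanFn.comp ((measurable_inner_const β₀).comp measurable_fst)
  exact ((measurable_snd.sub h1).div_const _).smul measurable_fst

/-- An entry of the information of a single observation with covariate vector `v`. -/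
def unitInfo (F : ExpFamily) (β₀ : Vec p) (a b : Fin p) (v : Vec p) : ℝ :=
  F.varFn (inner ℝ v β₀) / F.φ * (v a * v b)

lemma measurable_unitInfo (a b : Fin p) : Measurable (unitInfo F β₀ a b) := by
  have h1 : Measurable fun v : Vec p => F.varFn (inner ℝ v β₀) :=
    F.measurable_varFn.comp (measurable_inner_const β₀)
  exact (h1.div_const _).mul (by fun_prop)

lemma info_apply (s : Finset ℕ) (v : ℕ → Vec p) (a b : Fin p) :
    info F s v F.φ β₀ a b = (s.card : ℝ)⁻¹ * ∑ i ∈ s, unitInfo F β₀ a b (v i) := by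
  simp [info, unitInfo, Matrix.sum_apply, vecMulVec_apply]

lemma fisherInfo_apply (a b : Fin p) :
    fisherInfo P F x β₀ a b = ∫ ω, unitInfo F β₀ a b (x 0 ω) ∂P := by
  simp [fisherInfo, info_apply]

namespace IsGLMSample

lemma ident_x (h : IsGLMSample P F x y β₀) (i : ℕ) : IdentDistrib (x i) (x 0) P P :=
  (h.ident i).comp measurable_fst

lemma indep_x (h : IsGLMSample P F x y β₀) : iIndepFun x P :=
  h.indep.comp (fun _ z => z.1) fun _ => measurable_fst

/-- Conditionally on the covariates, the variance of the response is `φ b''`. -/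
lemma lintegral_sq_residual [IsProbabilityMeasure P] (h : IsGLMSample P F x y β₀)
    (hΘ : ∀ᵐ ω ∂P, inner ℝ (x 0 ω) β₀ ∈ F.Θ) {g : Vec p → ℝ≥0∞} (hg : Measurable g) :
    ∫⁻ ω, g (x 0 ω) * ENNReal.ofReal ((y 0 ω - F.meanFn (inner ℝ (x 0 ω) β₀)) ^ 2) ∂P =
      ∫⁻ ω, g (x 0 ω) * ENNReal.ofReal (F.φ * F.varFn (inner ℝ (x 0 ω) β₀)) ∂P := by
  have hin := measurable_inner_const (p := p) β₀
  have hmean : Measurable fun v : Vec p => F.meanFn (inner ℝ v β₀) := F.measurable_meanFn.comp hin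
  have hvar : Measurable fun v : Vec p => F.varFn (inner ℝ v β₀) := F.measurable_varFn.comp hin
  have hΘm : ∀ᵐ v ∂(P.map (x 0)), inner ℝ v β₀ ∈ F.Θ :=
    (ae_map_iff (h.measurable_x 0).aemeasurable (F.isOpen_Θ.measurableSet.preimage hin)).2 hΘ
  -- Off `Θ` the cumulant function is arbitrary; a measurable version of the density is needed.
  set b' : ℝ → ℝ := F.Θ.indicator F.b with hb'
  have hb'm : Measurable b' := by
    refine measurable_of_measurable_union_cover (s := F.Θ) (t := F.Θᶜ)
      F.isOpen_Θ.measurableSet F.isOpen_Θ.measurableSet.compl (by simp) ?_ ?_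
    · have hc : ContinuousOn F.b F.Θ := fun θ hθ =>
        (F.hasDerivAt_b hθ).continuousAt.continuousWithinAt
      have he : (fun θ : F.Θ => b' θ) = F.Θ.domRestrict F.b := by
        funext θ; exact Set.indicator_of_mem θ.2 _
      rw [he]
      exact hc.domRestrict.measurable
    · have he : (fun θ : (F.Θᶜ : Set ℝ) => b' θ) = fun _ => 0 := by
        funext θ; exact Set.indicator_of_notMem θ.2 _
      rw [he]
      exact measurable_const
  set D : Vec p × ℝ → ℝ≥0∞ := fun z =>
    ENNReal.ofReal (Real.exp ((z.2 * inner ℝ z.1 β₀ - b' (inner ℝ z.1 β₀)) / F.φ + F.c z.2))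
  have hcm := F.measurable_c
  have hDm : Measurable D := by
    have h1 : Measurable fun z : Vec p × ℝ => (inner ℝ z.1 β₀ : ℝ) := hin.comp measurable_fst
    have h2 := hb'm.comp h1
    have h3 : Measurable fun z : Vec p × ℝ => F.c z.2 := hcm.comp measurable_snd
    exact ((((measurable_snd.mul h1).sub h2).div_const _).add h3).exp.ennreal_ofReal
  have hDv : ∀ v : Vec p, inner ℝ v β₀ ∈ F.Θ → ∀ u,
      D (v, u) = ENNReal.ofReal (F.density u (inner ℝ v β₀)) := fun v hv u => by
    simp [D, ExpFamily.density, hb', Set.indicator_of_mem hv]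
  have hlaw : P.map (fun ω => (x 0 ω, y 0 ω)) = ((P.map (x 0)).prod F.ν).withDensity D := by
    rw [h.law]
    refine withDensity_congr_ae ?_
    have hfst : ∀ᵐ z ∂((P.map (x 0)).prod F.ν), inner ℝ z.1 β₀ ∈ F.Θ :=
      Measure.quasiMeasurePreserving_fst.ae hΘm
    filter_upwards [hfst] with z hz using (hDv z.1 hz z.2).symm
  set G : Vec p × ℝ → ℝ≥0∞ := fun z =>
    g z.1 * ENNReal.ofReal ((z.2 - F.meanFn (inner ℝ z.1 β₀)) ^ 2) with hG
  have hGm : Measurable G :=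
    (hg.comp measurable_fst).mul
      (((measurable_snd.sub (hmean.comp measurable_fst)).pow_const 2).ennreal_ofReal)
  have hprob : IsProbabilityMeasure (P.map (x 0)) :=
    Measure.isProbabilityMeasure_map (h.measurable_x 0).aemeasurable
  calc ∫⁻ ω, g (x 0 ω) * ENNReal.ofReal ((y 0 ω - F.meanFn (inner ℝ (x 0 ω) β₀)) ^ 2) ∂P
      = ∫⁻ z, G z ∂(P.map (fun ω => (x 0 ω, y 0 ω))) :=
        (lintegral_map hGm ((h.measurable_x 0).prodMk (h.measurable_y 0))).symm
    _ = ∫⁻ z, D z * G z ∂((P.map (x 0)).prod F.ν) := by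
        rw [hlaw, lintegral_withDensity_eq_lintegral_mul _ hDm hGm]; rfl
    _ = ∫⁻ v, ∫⁻ u, D (v, u) * G (v, u) ∂F.ν ∂(P.map (x 0)) :=
        lintegral_prod _ (hDm.mul hGm).aemeasurable
    _ = ∫⁻ v, g v * ENNReal.ofReal (F.φ * F.varFn (inner ℝ v β₀)) ∂(P.map (x 0)) := by
        refine lintegral_congr_ae ?_
        filter_upwards [hΘm] with v hv
        rw [← (ExpFamily.lintegral_sq_sub_meanFn hv).2]
        simp_rw [← hDv v hv]
        have hDvm : Measurable fun u => D (v, u) := hDm.comp measurable_prodMk_left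
        rw [← lintegral_const_mul _ (by fun_prop)]
        refine lintegral_congr fun u => ?_
        simp only [hG]
        ring
    _ = _ := lintegral_map (hg.mul ((hvar.const_mul _).ennreal_ofReal)) (h.measurable_x 0)

end IsGLMSample

section Regular

variable {V : Set (Vec p)} {δ L A M : ℝ}

lemma IsRegularOn.varFn_pos₀ (hreg : IsRegularOn F β₀ V δ L A M) {v : Vec p} (hv : v ∈ V) :
    0 < F.varFn (inner ℝ v β₀) := hreg.varFn_pos β₀ (by simpa [l1] using hreg.δ_pos) v hv

lemma IsRegularOn.mem_Θ₀ (hreg : IsRegularOn F β₀ V δ L A M) {v : Vec p} (hv : v ∈ V) :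
    inner ℝ v β₀ ∈ F.Θ := hreg.mem_Θ β₀ (by simpa [l1] using hreg.δ_pos) v hv

lemma IsRegularOn.abs_unitInfo_le (hreg : IsRegularOn F β₀ V δ L A M) {v : Vec p} (hv : v ∈ V)
    (a b : Fin p) : |unitInfo F β₀ a b v| ≤ A / F.φ * (M * M) := by
  have hφ := F.φ_pos
  have hA := hreg.A_nonneg
  have hM := hreg.M_nonneg
  have hc : ∀ a, |v a| ≤ M := fun a => by
    simpa using (PiLp.norm_apply_le v a).trans (hreg.norm_le v hv)
  rw [unitInfo, abs_mul, abs_mul, abs_div, abs_of_pos hφ, abs_of_pos (hreg.varFn_pos₀ hv)]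
  gcongr
  · exact hreg.varFn_le v hv
  · exact hc a
  · exact hc b

variable [IsProbabilityMeasure P]

lemma integrable_unitInfo (h : IsGLMSample P F x y β₀) (hreg : IsRegularOn F β₀ V δ L A M)
    (hV : ∀ i, ∀ᵐ ω ∂P, x i ω ∈ V) (i : ℕ) (a b : Fin p) :
    Integrable (fun ω => unitInfo F β₀ a b (x i ω)) P := by
  refine Integrable.of_bound (C := A / F.φ * (M * M))
    ((measurable_unitInfo a b).comp (h.measurable_x i)).aestronglyMeasurable ?_
  filter_upwards [hV i] with ω hω using hreg.abs_unitInfo_le hω a b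

/-- The expected information of any number of observations is the Fisher information. -/
lemma integral_info_range (h : IsGLMSample P F x y β₀) (hreg : IsRegularOn F β₀ V δ L A M)
    (hV : ∀ i, ∀ᵐ ω ∂P, x i ω ∈ V) {N : ℕ} (hN : 0 < N) (a b : Fin p) :
    Integrable (fun ω => info F (Finset.range N) (fun l => x l ω) F.φ β₀ a b) P ∧
      ∫ ω, info F (Finset.range N) (fun l => x l ω) F.φ β₀ a b ∂P
        = fisherInfo P F x β₀ a b := by
  simp_rw [info_apply]
  have hi := fun i => integrable_unitInfo h hreg hV i a b
  refine ⟨(integrable_finsetSum _ fun i _ => hi i).const_mul _, ?_⟩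
  rw [integral_const_mul, integral_finsetSum _ fun i _ => hi i, fisherInfo_apply]
  have : ∀ i ∈ Finset.range N, ∫ ω, unitInfo F β₀ a b (x i ω) ∂P =
      ∫ ω, unitInfo F β₀ a b (x 0 ω) ∂P := fun i _ =>
    ((h.ident_x i).comp (measurable_unitInfo a b)).integral_eq
  rw [Finset.sum_congr rfl this, Finset.sum_const, Finset.card_range, nsmul_eq_mul,
    inv_mul_cancel_left₀ (by exact_mod_cast hN.ne')]

/-- The quadratic form of the Fisher information. -/
lemma dotProduct_fisherInfo (h : IsGLMSample P F x y β₀) (hreg : IsRegularOn F β₀ V δ L A M)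
    (hV : ∀ i, ∀ᵐ ω ∂P, x i ω ∈ V) (t : Vec p) :
    Integrable (fun ω => F.varFn (inner ℝ (x 0 ω) β₀) / F.φ * (inner ℝ (x 0 ω) t : ℝ) ^ 2) P ∧
    t.ofLp ⬝ᵥ fisherInfo P F x β₀ *ᵥ t.ofLp =
      ∫ ω, F.varFn (inner ℝ (x 0 ω) β₀) / F.φ * (inner ℝ (x 0 ω) t : ℝ) ^ 2 ∂P := by
  have hi := fun a b => integrable_unitInfo h hreg hV 0 a b
  have heq : (fun ω => F.varFn (inner ℝ (x 0 ω) β₀) / F.φ * (inner ℝ (x 0 ω) t : ℝ) ^ 2) =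
      fun ω => ∑ a, ∑ b, t a * t b * unitInfo F β₀ a b (x 0 ω) := by
    funext ω
    have : (inner ℝ (x 0 ω) t : ℝ) = ∑ a, x 0 ω a * t a := inner_eq_dotProduct _ _
    rw [this, sq, Finset.sum_mul_sum, Finset.mul_sum]
    refine Finset.sum_congr rfl fun a _ => ?_
    rw [Finset.mul_sum]
    refine Finset.sum_congr rfl fun b _ => ?_
    rw [unitInfo]
    ring
  rw [heq]
  refine ⟨integrable_finsetSum _ fun a _ => integrable_finsetSum _ fun b _ =>
    (hi a b).const_mul _, ?_⟩
  rw [integral_finsetSum _ fun a _ => integrable_finsetSum _ fun b _ => (hi a b).const_mul _]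
  simp only [dotProduct, mulVec, Finset.mul_sum]
  refine Finset.sum_congr rfl fun a _ => ?_
  rw [integral_finsetSum _ fun b _ => (hi a b).const_mul _]
  refine Finset.sum_congr rfl fun b _ => ?_
  rw [integral_const_mul, fisherInfo_apply]
  ring

/-- The covariance matrix of the score is the Fisher information. -/
lemma unitScore_second_moment (h : IsGLMSample P F x y β₀) (hreg : IsRegularOn F β₀ V δ L A M)
    (hV : ∀ i, ∀ᵐ ω ∂P, x i ω ∈ V) (t : Vec p) :
    MemLp (fun ω => (inner ℝ (unitScore F β₀ (x 0 ω, y 0 ω)) t : ℝ)) 2 P ∧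
      ∫ ω, (inner ℝ (unitScore F β₀ (x 0 ω, y 0 ω)) t : ℝ) ^ 2 ∂P =
        t.ofLp ⬝ᵥ fisherInfo P F x β₀ *ᵥ t.ofLp := by
  have hφ := F.φ_pos
  have hΘ : ∀ᵐ ω ∂P, inner ℝ (x 0 ω) β₀ ∈ F.Θ := by
    filter_upwards [hV 0] with ω hω using hreg.mem_Θ₀ hω
  obtain ⟨hint, hquad⟩ := dotProduct_fisherInfo h hreg hV t
  have hm : Measurable fun ω => (inner ℝ (unitScore F β₀ (x 0 ω, y 0 ω)) t : ℝ) :=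
    (measurable_inner_const t).comp
      (measurable_unitScore.comp ((h.measurable_x 0).prodMk (h.measurable_y 0)))
  have hnn : 0 ≤ᵐ[P] fun ω =>
      F.varFn (inner ℝ (x 0 ω) β₀) / F.φ * (inner ℝ (x 0 ω) t : ℝ) ^ 2 := by
    filter_upwards [hV 0] with ω hω
    have := (hreg.varFn_pos₀ hω).le
    positivity
  have key : ∫⁻ ω, ENNReal.ofReal ((inner ℝ (unitScore F β₀ (x 0 ω, y 0 ω)) t : ℝ) ^ 2) ∂P =
      ∫⁻ ω, ENNReal.ofReal
        (F.varFn (inner ℝ (x 0 ω) β₀) / F.φ * (inner ℝ (x 0 ω) t : ℝ) ^ 2) ∂P := by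
    have h1 := h.lintegral_sq_residual hΘ
      (g := fun v => ENNReal.ofReal (((inner ℝ v t : ℝ) / F.φ) ^ 2))
      ((((measurable_inner_const t).div_const _).pow_const 2).ennreal_ofReal)
    convert h1 using 1
    · refine lintegral_congr fun ω => ?_
      rw [← ENNReal.ofReal_mul (sq_nonneg _), unitScore, inner_smul_left]
      congr 1
      simp only [conj_trivial]
      ring
    · refine lintegral_congr fun ω => ?_
      rw [← ENNReal.ofReal_mul (sq_nonneg _)]
      congr 1
      field_simp
  have hsq : Integrable (fun ω => (inner ℝ (unitScore F β₀ (x 0 ω, y 0 ω)) t : ℝ) ^ 2) P := by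
    refine ⟨(hm.pow_const 2).aestronglyMeasurable, ?_⟩
    rw [hasFiniteIntegral_iff_ofReal (ae_of_all _ fun _ => sq_nonneg _), key,
      ← hasFiniteIntegral_iff_ofReal hnn]
    exact hint.2
  refine ⟨(memLp_two_iff_integrable_sq hm.aestronglyMeasurable).2 hsq, ?_⟩
  rw [hquad, integral_eq_lintegral_of_nonneg_ae (ae_of_all _ fun _ => sq_nonneg _) hsq.1, key,
    integral_eq_lintegral_of_nonneg_ae hnn hint.1]

/-- The Fisher information is positive definite if no hyperplane contains the covariates almost
surely. -/
lemma fisherInfo_posDef (h : IsGLMSample P F x y β₀) (hreg : IsRegularOn F β₀ V δ L A M)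
    (hV : ∀ i, ∀ᵐ ω ∂P, x i ω ∈ V)
    (hsupp : ∀ v : Vec p, (∀ᵐ ω ∂P, (inner ℝ (x 0 ω) v : ℝ) = 0) → v = 0) :
    (fisherInfo P F x β₀).PosDef := by
  have hφ := F.φ_pos
  have key : ∀ v : Vec p, v ≠ 0 → 0 < v.ofLp ⬝ᵥ fisherInfo P F x β₀ *ᵥ v.ofLp := fun v hv => by
    obtain ⟨hint, hquad⟩ := dotProduct_fisherInfo h hreg hV v
    rw [hquad]
    have hnn : 0 ≤ᵐ[P] fun ω =>
        F.varFn (inner ℝ (x 0 ω) β₀) / F.φ * (inner ℝ (x 0 ω) v : ℝ) ^ 2 := by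
      filter_upwards [hV 0] with ω hω
      have := (hreg.varFn_pos₀ hω).le
      positivity
    refine lt_of_le_of_ne (integral_nonneg_of_ae hnn) fun h0 => hv (hsupp v ?_)
    have h1 := (integral_eq_zero_iff_of_nonneg_ae hnn hint).1 h0.symm
    filter_upwards [h1, hV 0] with ω hω hωV
    have hpos := hreg.varFn_pos₀ hωV
    simpa [hpos.ne', hφ.ne'] using hω
  refine Matrix.PosDef.of_dotProduct_mulVec_pos ?_ fun v hv => ?_
  · ext a b
    simp only [conjTranspose_apply, star_trivial, fisherInfo_apply, unitInfo, mul_comm (x 0 _ b)]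
  · simpa using key (WithLp.toLp 2 v) (by simpa using hv)

/-- The law of large numbers for the sample information. -/
lemma tendsto_info (h : IsGLMSample P F x y β₀) (hreg : IsRegularOn F β₀ V δ L A M)
    (hV : ∀ i, ∀ᵐ ω ∂P, x i ω ∈ V) {N : ℕ → ℕ} (hN : Tendsto N atTop atTop) (a b : Fin p) :
    Tendsto (fun z : ℕ × Ω => info F (Finset.range (N z.1)) (fun i => x i z.2) F.φ β₀ a b)
      (whp P) (𝓝 (fisherInfo P F x β₀ a b)) := by
  have hm : ∀ i, Measurable fun ω => unitInfo F β₀ a b (x i ω) := fun i =>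
    (measurable_unitInfo a b).comp (h.measurable_x i)
  have hslln := strong_law_ae_real (μ := P) (fun i ω => unitInfo F β₀ a b (x i ω))
    (integrable_unitInfo h hreg hV 0 a b)
    (fun i j hij => (h.indep_x.indepFun hij).comp (measurable_unitInfo a b)
      (measurable_unitInfo a b))
    (fun i => (h.ident_x i).comp (measurable_unitInfo a b))
  have h1 := tendstoInMeasure_of_tendsto_ae
    (fun n => ((Finset.measurable_fun_sum _ fun i _ => hm i).div_const _).aestronglyMeasurable)
    hslln
  have h2 := h1.comp hN
  rw [← fisherInfo_apply (P := P) a b] at h2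
  refine (tendstoInMeasure_const_iff.1 h2).congr fun z => ?_
  simp [info_apply, div_eq_inv_mul]

end Regular

/-- An i.i.d. sequence of which all entries of growing initial segments are bounded in
probability is bounded. -/
lemma ae_le_of_iIndepFun [IsProbabilityMeasure P] {W : ℕ → Ω → ℝ}
    (hindep : iIndepFun W P) (hm : ∀ i, Measurable (W i))
    (hident : ∀ i, IdentDistrib (W i) (W 0) P P) {N : ℕ → ℕ} (hN : Tendsto N atTop atTop)
    {M : ℝ} (hM : ∀ᶠ m in atTop, P {ω | ∃ i < N m, M < W i ω} ≤ 1 / 2) (i : ℕ) :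
    ∀ᵐ ω ∂P, W i ω ≤ M := by
  have hset : ∀ i, {ω | W i ω ≤ M} = W i ⁻¹' Set.Iic M := fun i => rfl
  have hms : ∀ i, MeasurableSet {ω | W i ω ≤ M} := fun i => hm i measurableSet_Iic
  have hq : ∀ i, P {ω | W i ω ≤ M} = P {ω | W 0 ω ≤ M} := fun i =>
    (hident i).measure_mem_eq measurableSet_Iic
  have hpow : ∀ m, P {ω | ∃ i < N m, M < W i ω}ᶜ = P {ω | W 0 ω ≤ M} ^ N m := fun m => by
    have : {ω | ∃ i < N m, M < W i ω}ᶜ = ⋂ i ∈ Finset.range (N m), W i ⁻¹' Set.Iic M := by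
      ext ω; simp
    rw [this, hindep.measure_inter_preimage_eq_mul _ fun i _ => measurableSet_Iic]
    simp_rw [← hset, hq]
    simp
  have hge : ∀ᶠ m in atTop, 1 / 2 ≤ P {ω | W 0 ω ≤ M} ^ N m := by
    filter_upwards [hM] with m hm'
    have hms' : MeasurableSet {ω | ∃ i < N m, M < W i ω} := by
      have : {ω | ∃ i < N m, M < W i ω} = ⋃ i ∈ Finset.range (N m), W i ⁻¹' Set.Ioi M := by
        ext ω; simp
      rw [this]
      exact Finset.measurableSet_biUnion _ fun i _ => hm i measurableSet_Ioi
    rw [← hpow, prob_compl_eq_one_sub hms']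
    calc (1 : ℝ≥0∞) / 2 = 1 - 1 / 2 := by
          rw [one_div]; exact ENNReal.one_sub_inv_two.symm
      _ ≤ _ := tsub_le_tsub_left hm' 1
  have hone : P {ω | W 0 ω ≤ M} = 1 := by
    by_contra hne
    have hlt : P {ω | W 0 ω ≤ M} < 1 := lt_of_le_of_ne prob_le_one hne
    have h0 := (ENNReal.tendsto_pow_atTop_nhds_zero_of_lt_one hlt).comp hN
    have := ge_of_tendsto h0 hge
    simp at this
  rw [← prob_compl_eq_zero_iff (hms 0)] at hone
  have h0 : ∀ᵐ ω ∂P, W 0 ω ≤ M := hone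
  exact (hident i).symm.ae_snd (p := fun r => r ≤ M) measurableSet_Iic h0

end Moments

/-! ### Linearisation of the two estimators -/

section DeterministicLinearisation

variable {p K : ℕ} {F : ExpFamily} {β₀ : Vec p} {V : Set (Vec p)} {δ L A M : ℝ}

lemma act_info_eq (s : Finset ℕ) (x : ℕ → Vec p) (β v : Vec p) :
    act (info F s x F.φ β) v = (s.card : ℝ)⁻¹ • infoSum F s x β v := by
  rw [act_info]; rfl

/-- The weighted average solves the linearised full-data score equation, up to an error that is
small if the dispersion estimates are close to `φ` and the initial estimates are close to `β₀`. -/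
lemma norm_linearisation_weightedAverage (h : IsRegularOn F β₀ V δ L A M)
    {s : Fin K → Finset ℕ} {t : Finset ℕ} {x : ℕ → Vec p} {y : ℕ → ℝ} (hK : 0 < K)
    (hs : ∀ k, 0 < (s k).card) (hst : ∀ f : ℕ → Vec p, ∑ k, ∑ i ∈ s k, f i = ∑ i ∈ t, f i)
    (hcard : ∀ k, (s k).card ≤ t.card) (hx : ∀ i, x i ∈ V)
    {ψ : Fin K → ℝ} {β : Fin K → Vec p} (hβ : ∀ k, l1 (β k - β₀) < δ)
    (hI : ∀ k, (info F (s k) x (ψ k) (β k)).PosDef) (J : Matrix (Fin p) (Fin p) ℝ) :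
    ‖act J (Real.sqrt t.card • (weightedAverage F s x y ψ β - β₀)) -
        (Real.sqrt t.card)⁻¹ • scoreSum F t x y β₀‖ ≤
      (∑ k, (|F.φ / ψ k - 1| * ‖(Real.sqrt t.card)⁻¹ • scoreSum F (s k) x y β₀‖ +
        |F.φ / ψ k| * (2 * (L * M ^ 3 / F.φ)) *
          (Real.sqrt (s k).card * ‖β k - β₀‖ * ‖β k - β₀‖))) +
      ((∑ a, ∑ b, |J a b - info F t x F.φ β₀ a b|) +
        ∑ k, (|F.φ / ψ k - 1| * (A * M ^ 2 / F.φ) +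
          |F.φ / ψ k| * (L * M ^ 3 / F.φ * ‖β k - β₀‖))) *
        ‖Real.sqrt t.card • (weightedAverage F s x y ψ β - β₀)‖ := by
  have hφ := F.φ_pos
  have hL := h.L_nonneg
  have hA := h.A_nonneg
  have hM := h.M_nonneg
  set N : ℝ := (t.card : ℝ) with hN
  have hNpos : 0 < N := by
    exact Nat.cast_pos.2 ((hs ⟨0, hK⟩).trans_le (hcard ⟨0, hK⟩))
  have hsq : 0 < Real.sqrt N := Real.sqrt_pos.2 hNpos
  have hss : Real.sqrt N * Real.sqrt N = N := Real.mul_self_sqrt hNpos.le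
  set d := weightedAverage F s x y ψ β - β₀ with hd
  set u := Real.sqrt N • d with hu
  set H := ∑ k, ((s k).card : ℝ) • info F (s k) x (ψ k) (β k) with hH
  have hHact : ∀ v, act H v = ∑ k, (F.φ / ψ k) • infoSum F (s k) x (β k) v := fun v => by
    rw [hH, sum_act]
    exact Finset.sum_congr rfl fun k _ => by rw [smul_act, card_smul_act_info]
  have hHd : act H d = ∑ k, (F.φ / ψ k) •
      (infoSum F (s k) x (β k) (β k - β₀) + scoreSum F (s k) x y (β k)) :=
    act_sum_info_weightedAverage_sub hK hs hI β₀
  have hG : ∀ v, infoSum F t x β₀ v = ∑ k, infoSum F (s k) x β₀ v := fun v => (hst _).symm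
  have hU : scoreSum F t x y β₀ = ∑ k, scoreSum F (s k) x y β₀ := (hst _).symm
  have hNH : N⁻¹ • act H u = (Real.sqrt N)⁻¹ • act H d := by
    rw [hu, act_smul, smul_smul]
    congr 1
    field_simp
    rw [sq, hss]
  -- Three errors: of the information at `β₀` against `J`, of the estimated information against that
  -- at `β₀`, and the remainder of the Newton steps.
  have hsplit : act J u - (Real.sqrt N)⁻¹ • scoreSum F t x y β₀ =
      act (J - info F t x F.φ β₀) u + N⁻¹ • (infoSum F t x β₀ u - act H u) +
        (Real.sqrt N)⁻¹ • (act H d - scoreSum F t x y β₀) := by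
    rw [sub_act, act_info_eq, smul_sub, smul_sub, hNH]
    abel
  have e1 : ‖act (J - info F t x F.φ β₀) u‖ ≤
      (∑ a, ∑ b, |J a b - info F t x F.φ β₀ a b|) * ‖u‖ := norm_act_le _ _
  have hcardN : ∀ k, ((s k).card : ℝ) ≤ N := fun k => Nat.cast_le.2 (hcard k)
  have e2 : ‖N⁻¹ • (infoSum F t x β₀ u - act H u)‖ ≤
      (∑ k, (|F.φ / ψ k - 1| * (A * M ^ 2 / F.φ) +
          |F.φ / ψ k| * (L * M ^ 3 / F.φ * ‖β k - β₀‖))) * ‖u‖ := by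
    rw [norm_smul, Real.norm_eq_abs, abs_of_pos (inv_pos.2 hNpos), inv_mul_le_iff₀ hNpos, hG, hHact,
      ← Finset.sum_sub_distrib, Finset.sum_mul, Finset.mul_sum]
    refine (norm_sum_le _ _).trans (Finset.sum_le_sum fun k _ => ?_)
    have h1 := h.norm_infoSum_le (s := s k) (fun i _ => hx i) u
    have h2 := h.norm_infoSum_sub_le (s := s k) (fun i _ => hx i) (hβ k) u
    have hrw : infoSum F (s k) x β₀ u - (F.φ / ψ k) • infoSum F (s k) x (β k) u =
        -((F.φ / ψ k - 1) • infoSum F (s k) x β₀ u + (F.φ / ψ k) •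
          (infoSum F (s k) x (β k) u - infoSum F (s k) x β₀ u)) := by
      rw [sub_smul, one_smul, smul_sub]; abel
    rw [hrw, norm_neg]
    refine (norm_add_le _ _).trans ?_
    rw [norm_smul, norm_smul, Real.norm_eq_abs, Real.norm_eq_abs]
    calc _ ≤ |F.φ / ψ k - 1| * (N * (A * M ^ 2 / F.φ * ‖u‖)) +
          |F.φ / ψ k| * (N * (L * M ^ 3 / F.φ * ‖β k - β₀‖ * ‖u‖)) := by
          refine add_le_add (mul_le_mul_of_nonneg_left (h1.trans ?_) (abs_nonneg _))
            (mul_le_mul_of_nonneg_left (h2.trans ?_) (abs_nonneg _))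
          · exact mul_le_mul_of_nonneg_right (hcardN k) (by positivity)
          · exact mul_le_mul_of_nonneg_right (hcardN k) (by positivity)
      _ = _ := by ring
  have e3 : ‖(Real.sqrt N)⁻¹ • (act H d - scoreSum F t x y β₀)‖ ≤
      ∑ k, (|F.φ / ψ k - 1| * ‖(Real.sqrt N)⁻¹ • scoreSum F (s k) x y β₀‖ +
        |F.φ / ψ k| * (2 * (L * M ^ 3 / F.φ)) *
          (Real.sqrt (s k).card * ‖β k - β₀‖ * ‖β k - β₀‖)) := by
    rw [hHd, hU, ← Finset.sum_sub_distrib, Finset.smul_sum]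
    refine (norm_sum_le _ _).trans (Finset.sum_le_sum fun k _ => ?_)
    have h1 := h.norm_newton_sub_le (s := s k) (y := y) (fun i _ => hx i) (hβ k)
    have hrw : (Real.sqrt N)⁻¹ • ((F.φ / ψ k) •
          (infoSum F (s k) x (β k) (β k - β₀) + scoreSum F (s k) x y (β k)) -
          scoreSum F (s k) x y β₀) =
        (F.φ / ψ k - 1) • ((Real.sqrt N)⁻¹ • scoreSum F (s k) x y β₀) + (F.φ / ψ k) •
          ((Real.sqrt N)⁻¹ • (infoSum F (s k) x (β k) (β k - β₀) + scoreSum F (s k) x y (β k)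
            - scoreSum F (s k) x y β₀)) := by
      module
    rw [hrw]
    refine (norm_add_le _ _).trans ?_
    rw [norm_smul, norm_smul (F.φ / ψ k), Real.norm_eq_abs, Real.norm_eq_abs, mul_assoc |F.φ / ψ k|]
    refine add_le_add le_rfl (mul_le_mul_of_nonneg_left ?_ (abs_nonneg _))
    rw [norm_smul, Real.norm_eq_abs, abs_of_pos (inv_pos.2 hsq), inv_mul_le_iff₀ hsq]
    refine h1.trans ?_
    have hcs : Real.sqrt (s k).card * Real.sqrt (s k).card = (s k).card :=
      Real.mul_self_sqrt (Nat.cast_nonneg _)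
    have hcle : ((s k).card : ℝ) ≤ Real.sqrt N * Real.sqrt (s k).card := by
      have := mul_le_mul_of_nonneg_right (Real.sqrt_le_sqrt (hcardN k))
        (Real.sqrt_nonneg (s k).card)
      rwa [hcs] at this
    calc ((s k).card : ℝ) * (2 * (L * M ^ 3 / F.φ) * ‖β k - β₀‖ ^ 2)
        ≤ (Real.sqrt N * Real.sqrt (s k).card) * (2 * (L * M ^ 3 / F.φ) * ‖β k - β₀‖ ^ 2) :=
          mul_le_mul_of_nonneg_right hcle (by positivity)
      _ = _ := by ring
  rw [hsplit]
  refine (norm_add₃_le).trans ?_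
  linarith [e1, e2, e3]

section MaximumLikelihood

variable {t : Finset ℕ} {x : ℕ → Vec p} {y : ℕ → ℝ} {βhat : Vec p}

/-- By concavity of the log-likelihood, the score at any parameter points towards the
maximiser. -/
lemma inner_scoreSum_nonneg (hmax : IsArgmax (likelihood F t x y) (paramSet F t x) βhat)
    {β : Vec p} (hβ : β ∈ paramSet F t x) :
    0 ≤ (inner ℝ (scoreSum F t x y β) (βhat - β) : ℝ) := by
  have hφ := F.φ_pos
  have h1 : likelihood F t x y β ≤ likelihood F t x y βhat := hmax.2 hβ
  simp only [likelihood, ExpFamily.density, ← Real.exp_sum, Real.exp_le_exp,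
    Finset.sum_add_distrib, add_le_add_iff_right] at h1
  rw [scoreSum, sum_inner]
  refine (sub_nonneg.2 h1).trans ?_
  rw [← Finset.sum_sub_distrib]
  refine Finset.sum_le_sum fun i hi => ?_
  have htan := F.tangent_le_b (hβ i hi) (hmax.1 i hi)
  rw [inner_smul_left, inner_sub_right, ← sub_div, conj_trivial, div_mul_eq_mul_div]
  gcongr
  nlinarith

/-- The score vanishes at the maximum likelihood estimator, because the parameter set is open. -/
lemma scoreSum_eq_zero (hmax : IsArgmax (likelihood F t x y) (paramSet F t x) βhat) :
    scoreSum F t x y βhat = 0 := by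
  set v := scoreSum F t x y βhat with hv
  have hlin : ∀ i, Continuous fun τ : ℝ => (inner ℝ (x i) (βhat + τ • v) : ℝ) := fun i => by
    fun_prop
  have hmem : ∀ᶠ τ in 𝓝 (0 : ℝ), βhat + τ • v ∈ paramSet F t x := by
    have : ∀ᶠ τ in 𝓝 (0 : ℝ), ∀ i ∈ t, inner ℝ (x i) (βhat + τ • v) ∈ F.Θ := by
      refine (Finset.eventually_all t).2 fun i hi => ?_
      exact (hlin i).continuousAt.eventually_mem
        (F.isOpen_Θ.mem_nhds (by simpa using hmax.1 i hi))
    exact this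
  have hcont : ContinuousAt (fun τ : ℝ => (inner ℝ (scoreSum F t x y (βhat + τ • v)) v : ℝ)) 0 := by
    refine ContinuousAt.inner (𝕜 := ℝ) ?_ continuousAt_const
    unfold scoreSum
    refine tendsto_finsetSum _ fun i hi => ?_
    have hm : ContinuousAt F.meanFn (inner ℝ (x i) (βhat + (0 : ℝ) • v)) :=
      (F.hasDerivAt_meanFn (by simpa using hmax.1 i hi)).continuousAt
    have hm' := ContinuousAt.comp (f := fun τ : ℝ => (inner ℝ (x i) (βhat + τ • v) : ℝ)) hm
      (hlin i).continuousAt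
    exact ((continuousAt_const.sub hm').div_const _).smul continuousAt_const
  have hle : ∀ᶠ τ in 𝓝[>] (0 : ℝ),
      (inner ℝ (scoreSum F t x y (βhat + τ • v)) v : ℝ) ≤ 0 := by
    filter_upwards [hmem.filter_mono nhdsWithin_le_nhds, self_mem_nhdsWithin] with τ hτ hτ0
    have h1 := inner_scoreSum_nonneg hmax hτ
    rw [show βhat - (βhat + τ • v) = (-τ) • v by simp, inner_smul_right] at h1
    nlinarith [Set.mem_Ioi.1 hτ0]
  have h0 := le_of_tendsto (hcont.tendsto.mono_left nhdsWithin_le_nhds) hle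
  rw [zero_smul, add_zero, ← hv] at h0
  rw [real_inner_self_eq_norm_sq] at h0
  exact norm_eq_zero.1 (pow_eq_zero_iff two_ne_zero |>.1 (le_antisymm h0 (sq_nonneg _)))

/-- If the score at the true value is small and the sample information is close to a matrix that
is bounded below by `κ`, then the maximum likelihood estimator is close to the true value. -/
lemma norm_mle_sub_le (h : IsRegularOn F β₀ V δ L A M) (hx : ∀ i, x i ∈ V)
    (hmax : IsArgmax (likelihood F t x y) (paramSet F t x) βhat) (ht : 0 < t.card)
    {J : Matrix (Fin p) (Fin p) ℝ} {κ ρ : ℝ}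
    (hJ : ∀ v : Vec p, κ * ‖v‖ ^ 2 ≤ inner ℝ v (act J v)) (hρ : 0 < ρ) (hρδ : p * ρ < δ)
    (hU : ‖scoreSum F t x y β₀‖ < t.card * (κ / 4 * ρ))
    (hq : ∑ a, ∑ b, |J a b - info F t x F.φ β₀ a b| < κ / 4)
    (hC : L * M ^ 3 / F.φ * ρ < κ / 4) : ‖βhat - β₀‖ ≤ ρ := by
  by_contra hc
  push Not at hc
  set d := βhat - β₀ with hd
  have hd0 : 0 < ‖d‖ := hρ.trans hc
  set v := (ρ / ‖d‖) • d with hv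
  have hvn : ‖v‖ = ρ := by
    rw [hv, norm_smul, Real.norm_eq_abs, abs_of_pos (by positivity), div_mul_cancel₀ _ hd0.ne']
  have hvl : l1 (β₀ + v - β₀) < δ := by
    rw [add_sub_cancel_left]
    exact ((l1_le_norm v).trans_eq (by rw [hvn])).trans_lt hρδ
  have hmem : β₀ + v ∈ paramSet F t x := fun i _ => h.mem_Θ _ hvl _ (hx i)
  have h1 := inner_scoreSum_nonneg hmax hmem
  have hdv : βhat - (β₀ + v) = (‖d‖ / ρ - 1) • v := by
    rw [hv, smul_smul, sub_mul, div_mul_div_cancel₀ hρ.ne', one_mul, div_self hd0.ne', sub_smul,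
      one_smul, hd]
    abel
  have hfac : 0 < ‖d‖ / ρ - 1 := by rw [sub_pos, one_lt_div hρ]; exact hc
  rw [hdv, inner_smul_right] at h1
  have h2 := nonneg_of_mul_nonneg_right h1 hfac
  have h3 := h.norm_scoreSum_sub_le (s := t) (y := y) (fun i _ => hx i) hvl
  rw [add_sub_cancel_left, hvn] at h3
  set N : ℝ := (t.card : ℝ)
  have hN : 0 < N := Nat.cast_pos.2 ht
  set E := scoreSum F t x y (β₀ + v) - scoreSum F t x y β₀ + infoSum F t x β₀ v with hE
  have hSE : scoreSum F t x y (β₀ + v) = E + scoreSum F t x y β₀ - infoSum F t x β₀ v := by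
    rw [hE]; abel
  rw [hSE, inner_sub_left, inner_add_left] at h2
  have b1 : (inner ℝ E v : ℝ) ≤ N * (L * M ^ 3 / F.φ * ρ ^ 2) * ρ :=
    (real_inner_le_norm _ _).trans (by rw [hvn]; exact mul_le_mul_of_nonneg_right h3 hρ.le)
  have b2 : (inner ℝ (scoreSum F t x y β₀) v : ℝ) ≤ N * (κ / 4 * ρ) * ρ :=
    (real_inner_le_norm _ _).trans (by rw [hvn]; exact mul_le_mul_of_nonneg_right hU.le hρ.le)
  have b3 : N * (κ - κ / 4) * ρ ^ 2 ≤ (inner ℝ (infoSum F t x β₀ v) v : ℝ) := by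
    have e1 : infoSum F t x β₀ v = N • act (info F t x F.φ β₀) v := by
      rw [act_info_eq, smul_inv_smul₀ hN.ne']
    have e2 : (inner ℝ v (act J v) : ℝ) - inner ℝ v (act (info F t x F.φ β₀) v) ≤
        κ / 4 * ρ ^ 2 := by
      rw [← inner_sub_right, ← sub_act]
      refine (real_inner_le_norm _ _).trans ?_
      have := norm_act_le (J - info F t x F.φ β₀) v
      rw [hvn] at this ⊢
      have h4 : ‖act (J - info F t x F.φ β₀) v‖ ≤ κ / 4 * ρ :=
        this.trans (mul_le_mul_of_nonneg_right hq.le hρ.le)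
      nlinarith
    have e3 := hJ v
    rw [hvn] at e3
    rw [e1, inner_smul_left, real_inner_comm]
    simp only [conj_trivial]
    rw [mul_assoc]
    exact mul_le_mul_of_nonneg_left (by linarith) hN.le
  have b4 : N * (L * M ^ 3 / F.φ * ρ ^ 2) * ρ ≤ N * (κ / 4) * ρ ^ 2 := by
    have := mul_le_mul_of_nonneg_left hC.le (mul_nonneg hN.le (sq_nonneg ρ))
    linarith
  have hκ : 0 < κ := by
    have : 0 ≤ ∑ a, ∑ b, |J a b - info F t x F.φ β₀ a b| :=
      Finset.sum_nonneg fun _ _ => Finset.sum_nonneg fun _ _ => abs_nonneg _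
    linarith
  have : 0 < N * κ * ρ ^ 2 := mul_pos (mul_pos hN hκ) (pow_pos hρ 2)
  linarith

/-- The maximum likelihood estimator solves the linearised score equation. -/
lemma norm_linearisation_mle (h : IsRegularOn F β₀ V δ L A M) (hx : ∀ i, x i ∈ V)
    (hmax : IsArgmax (likelihood F t x y) (paramSet F t x) βhat) (ht : 0 < t.card)
    (hβ : l1 (βhat - β₀) < δ) (J : Matrix (Fin p) (Fin p) ℝ) :
    ‖act J (Real.sqrt t.card • (βhat - β₀)) - (Real.sqrt t.card)⁻¹ • scoreSum F t x y β₀‖ ≤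
      ((∑ a, ∑ b, |J a b - info F t x F.φ β₀ a b|) + L * M ^ 3 / F.φ * ‖βhat - β₀‖) *
        ‖Real.sqrt t.card • (βhat - β₀)‖ := by
  have h3 := h.norm_scoreSum_sub_le (s := t) (y := y) (fun i _ => hx i) hβ
  rw [scoreSum_eq_zero hmax, zero_sub] at h3
  set N : ℝ := (t.card : ℝ)
  have hN : 0 < N := Nat.cast_pos.2 ht
  have hsq : 0 < Real.sqrt N := Real.sqrt_pos.2 hN
  have hss : Real.sqrt N * Real.sqrt N = N := Real.mul_self_sqrt hN.le
  set d := βhat - β₀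
  set u := Real.sqrt N • d with hu
  have hsplit : act J u - (Real.sqrt N)⁻¹ • scoreSum F t x y β₀ =
      act (J - info F t x F.φ β₀) u +
        (Real.sqrt N)⁻¹ • (-scoreSum F t x y β₀ + infoSum F t x β₀ d) := by
    have : act (info F t x F.φ β₀) u = (Real.sqrt N)⁻¹ • infoSum F t x β₀ d := by
      rw [hu, act_smul, act_info_eq, smul_smul]
      congr 1
      change Real.sqrt N * N⁻¹ = _
      field_simp
      rw [sq, hss]
    rw [sub_act, this, smul_add, smul_neg]
    abel
  rw [hsplit, add_mul]
  refine (norm_add_le _ _).trans (add_le_add (norm_act_le _ _) ?_)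
  rw [norm_smul, Real.norm_eq_abs, abs_of_pos (inv_pos.2 hsq), inv_mul_le_iff₀ hsq]
  refine h3.trans_eq ?_
  rw [hu, norm_smul, Real.norm_eq_abs, abs_of_pos hsq]
  linear_combination (-(L * M ^ 3 / F.φ * ‖d‖ ^ 2)) * hss

end MaximumLikelihood

/-- The smallest eigenvalue of a positive definite matrix is positive. -/
lemma exists_pos_le_inner_act {J : Matrix (Fin p) (Fin p) ℝ} (hJ : J.PosDef) :
    ∃ κ > 0, ∀ v : Vec p, κ * ‖v‖ ^ 2 ≤ inner ℝ v (act J v) := by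
  have hpos : ∀ v : Vec p, v ≠ 0 → 0 < (inner ℝ v (act J v) : ℝ) := fun v hv => by
    have := hJ.dotProduct_mulVec_pos (x := v.ofLp) (by rwa [ne_eq, WithLp.ofLp_eq_zero])
    rw [inner_act_eq_dotProduct]
    simpa using this
  have hunit : ∀ v : Vec p, v ≠ 0 → ‖v‖⁻¹ • v ∈ Metric.sphere (0 : Vec p) 1 := fun v hv => by
    rw [mem_sphere_zero_iff_norm, norm_smul, norm_inv, norm_norm,
      inv_mul_cancel₀ (norm_ne_zero_iff.2 hv)]
  rcases (Metric.sphere (0 : Vec p) 1).eq_empty_or_nonempty with he | hne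
  · refine ⟨1, one_pos, fun v => ?_⟩
    have hv : v = 0 := by
      by_contra hv
      have : (‖v‖⁻¹ • v) ∈ Metric.sphere (0 : Vec p) 1 := hunit v hv
      simp [he] at this
    simp [hv]
  · have hcont : Continuous fun v : Vec p => (inner ℝ v (act J v) : ℝ) :=
      continuous_id.inner
        (LinearMap.continuous_of_finiteDimensional (Matrix.toEuclideanLin J))
    obtain ⟨w, hw, hmin⟩ := (isCompact_sphere (0 : Vec p) 1).exists_isMinOn hne hcont.continuousOn
    have hw0 : w ≠ 0 := by
      rintro rfl
      simp at hw
    refine ⟨_, hpos w hw0, fun v => ?_⟩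
    by_cases hv : v = 0
    · simp [hv]
    have hvn : ‖v‖ ≠ 0 := norm_ne_zero_iff.2 hv
    have h1 := hmin (hunit v hv)
    simp only [Set.mem_ofPred_eq, act_smul, inner_smul_left, inner_smul_right] at h1
    simp only [conj_trivial] at h1
    calc _ ≤ ‖v‖⁻¹ * (‖v‖⁻¹ * inner ℝ v (act J v)) * ‖v‖ ^ 2 :=
          mul_le_mul_of_nonneg_right h1 (sq_nonneg _)
      _ = _ := by field_simp

end DeterministicLinearisation

/-! ### Stochastic orders of the sample quantities -/

section Asymptotics

variable {Ω : Type*} {p K : ℕ} {F : ExpFamily} {β₀ : Vec p} {x : ℕ → Ω → Vec p} {y : ℕ → Ω → ℝ}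
  {n : ℕ → Fin K → ℕ} {part : ℕ → Ω → ℕ → Fin K}

lemma nMin_le (m : ℕ) (k : Fin K) : nMin n m ≤ n m k := ciInf_le (OrderBot.bddBelow _) k

lemma le_nTot (m : ℕ) (k : Fin K) : n m k ≤ nTot n m :=
  Finset.single_le_sum (f := fun k => n m k) (fun _ _ => Nat.zero_le _) (Finset.mem_univ k)

lemma tendsto_blockSize (hn : Tendsto (nMin n) atTop atTop) (k : Fin K) :
    Tendsto (fun m => n m k) atTop atTop :=
  tendsto_atTop_mono (fun m => nMin_le m k) hn

lemma tendsto_nTot (hK : 0 < K) (hn : Tendsto (nMin n) atTop atTop) :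
    Tendsto (nTot n) atTop atTop :=
  tendsto_atTop_mono (fun m => le_nTot m ⟨0, hK⟩) (tendsto_blockSize hn _)

lemma sum_block (f : ℕ → Vec p) (m : ℕ) (ω : Ω) :
    ∑ k, ∑ i ∈ block n part m k ω, f i = ∑ i ∈ Finset.range (nTot n m), f i :=
  Finset.sum_fiberwise _ _ _

lemma scoreSum_range_eq_sum (m : ℕ) (ω : Ω) :
    scoreSum F (Finset.range (nTot n m)) (fun i => x i ω) (fun i => y i ω) β₀ =
      ∑ k, scoreSum F (block n part m k ω) (fun i => x i ω) (fun i => y i ω) β₀ :=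
  (sum_block _ m ω).symm

variable [MeasurableSpace Ω] {P : Measure Ω}

lemma tendsto_inv_sqrt_whp {N : ℕ → ℕ} (hN : Tendsto N atTop atTop) :
    Tendsto (fun z : ℕ × Ω => (Real.sqrt (N z.1))⁻¹) (whp P) (𝓝 0) :=
  (tendsto_inv_atTop_zero.comp (Real.tendsto_sqrt_atTop.comp
    (tendsto_natCast_atTop_atTop.comp hN))).comp tendsto_fst_whp

lemma eventually_pos_whp {N : ℕ → ℕ} (hN : Tendsto N atTop atTop) :
    ∀ᶠ z in whp P, 0 < N z.1 :=
  (hN.comp tendsto_fst_whp).eventually_gt_atTop 0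

/-- As the entries of all covariate vectors are bounded in probability, identically distributed
covariate vectors are almost surely bounded. -/
lemma exists_norm_le [IsProbabilityMeasure P] (h : IsGLMSample P F x y β₀) (hK : 0 < K)
    (hn : Tendsto (nMin n) atTop atTop)
    (hb : IsBigOP P (fun m ω => ⨆ k, maxAbs (block n part m k ω) (fun i => x i ω)) fun _ => 1) :
    ∃ M : ℝ, 0 ≤ M ∧ ∀ i, ∀ᵐ ω ∂P, ‖x i ω‖ ≤ M := by
  obtain ⟨M, hM0, hM⟩ := isBigOP_one_iff.1 hb (1 / 2) (by simp)
  refine ⟨p * M, by positivity, fun i => ?_⟩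
  have hcoord : ∀ j : Fin p, ∀ᵐ ω ∂P, |x i ω j| ≤ M := fun j => by
    have habs : Measurable fun v : Vec p => |v j| := by fun_prop
    refine ae_le_of_iIndepFun (W := fun i ω => |x i ω j|)
      (h.indep_x.comp (fun _ v => |v j|) fun _ => habs) (fun i => habs.comp (h.measurable_x i))
      (fun i => (h.ident_x i).comp habs) (tendsto_nTot hK hn) ?_ i
    refine hM.mono fun m hm => le_trans (measure_mono ?_) hm
    rintro ω ⟨l, hl, hlt⟩
    refine hlt.trans_le (le_trans ?_ (le_abs_self _))
    have hmem : l ∈ block n part m (part m ω l) ω :=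
      Finset.mem_filter.2 ⟨Finset.mem_range.2 hl, rfl⟩
    calc |x l ω j| ≤ maxAbs (block n part m (part m ω l) ω) (fun i => x i ω) :=
          le_ciSup (f := fun ij : block n part m (part m ω l) ω × Fin p =>
            |design (block n part m (part m ω l) ω) (fun i => x i ω) ij.1 ij.2|)
            (Set.finite_range _).bddAbove (⟨l, hmem⟩, j)
      _ ≤ _ := le_ciSup (f := fun k => maxAbs (block n part m k ω) (fun i => x i ω))
          (Set.finite_range _).bddAbove (part m ω l)
  filter_upwards [ae_all_iff.2 hcoord] with ω hω
  calc ‖x i ω‖ ≤ l1 (x i ω) := norm_le_l1 _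
    _ ≤ ∑ _j : Fin p, M := Finset.sum_le_sum fun j _ => hω j
    _ = p * M := by simp

variable {V : Set (Vec p)} {δ L A M : ℝ}

/-- The scores of the blocks are bounded in probability, at the rate of the full data. -/
lemma isBigOP_scoreSum_block [IsProbabilityMeasure P] (h : IsGLMSample P F x y β₀)
    (hreg : IsRegularOn F β₀ V δ L A M) (hV : ∀ i, ∀ᵐ ω ∂P, x i ω ∈ V)
    (hpart : IsRandomPartition P x y n part)
    (hmean : ∀ t, ∫ ω, (inner ℝ (unitScore F β₀ (x 0 ω, y 0 ω)) t : ℝ) ∂P = 0) (k : Fin K) :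
    IsBigOP P (fun m ω => ‖(Real.sqrt (nTot n m))⁻¹ •
      scoreSum F (block n part m k ω) (fun i => x i ω) (fun i => y i ω) β₀‖) fun _ => 1 := by
  set W : Fin p → ℕ → Ω → ℝ := fun j i ω => unitScore F β₀ (x i ω, y i ω) j with hWdef
  have hcm : ∀ j, Measurable fun z : Vec p × ℝ => unitScore F β₀ z j := fun j =>
    (by fun_prop : Measurable fun v : Vec p => v j).comp measurable_unitScore
  have hWm : ∀ j i, Measurable (W j i) := fun j i =>
    (hcm j).comp ((h.measurable_x i).prodMk (h.measurable_y i))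
  have hid : ∀ j i, IdentDistrib (W j i) (W j 0) P P := fun j i => (h.ident i).comp (hcm j)
  have hWin : ∀ j ω, W j 0 ω =
      inner ℝ (unitScore F β₀ (x 0 ω, y 0 ω)) (EuclideanSpace.single j (1 : ℝ)) := fun j ω => by
    simp only [hWdef, EuclideanSpace.inner_single_right]
    simp
  have hWL2 : ∀ j i, MemLp (W j i) 2 P := fun j i => by
    rw [(hid j i).memLp_iff]
    exact (unitScore_second_moment h hreg hV (EuclideanSpace.single j (1 : ℝ))).1.congr_norm
      (hWm j 0).aestronglyMeasurable (ae_of_all _ fun ω => by rw [hWin])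
  have hW0 : ∀ j i, ∫ ω, W j i ω ∂P = 0 := fun j i => by
    rw [(hid j i).integral_eq, ← hmean (EuclideanSpace.single j (1 : ℝ))]
    exact integral_congr_ae (ae_of_all _ fun ω => hWin j ω)
  have hcross : ∀ j i l, i ≠ l → ∫ ω, W j i ω * W j l ω ∂P = 0 := fun j i l hil => by
    have hind : IndepFun (W j i) (W j l) P := (h.indep.indepFun hil).comp (hcm j) (hcm j)
    rw [hind.integral_fun_mul_eq_mul_integral (hWm j i).aestronglyMeasurable
      (hWm j l).aestronglyMeasurable, hW0, zero_mul]
  have hσ : ∀ j i, ∫ ω, W j i ω * W j i ω ∂P = ∫ ω, W j 0 ω * W j 0 ω ∂P := fun j i =>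
    ((hid j i).comp (u := fun r => r * r) (by fun_prop)).integral_eq
  have hcoord : ∀ j, IsBigOP P (fun m ω => (Real.sqrt (nTot n m))⁻¹ *
      ∑ i ∈ Finset.range (nTot n m), (if part m ω i = k then 1 else 0) * W j i ω)
      fun _ => 1 := fun j => by
    have ham : ∀ i, Measurable fun f : ℕ → Fin K => (if f i = k then (1 : ℝ) else 0) := fun i =>
      (measurable_of_finite fun c : Fin K => if c = k then (1 : ℝ) else 0).comp
        (measurable_pi_apply i)
    have key : ∀ m, Integrable (fun ω => (∑ i ∈ Finset.range (nTot n m),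
        (if part m ω i = k then 1 else 0) * W j i ω) ^ 2) P ∧
        ∫ ω, (∑ i ∈ Finset.range (nTot n m), (if part m ω i = k then 1 else 0) * W j i ω) ^ 2 ∂P
          ≤ nTot n m * ∫ ω, W j 0 ω * W j 0 ω ∂P := fun m => by
      refine integral_sq_weighted_sum_le (W := W j)
        (a := fun i ω => if part m ω i = k then 1 else 0) (hWL2 j) (hcross j) (hσ j)
        (fun i => (ham i).comp (hpart.measurable m)) (fun i ω => by split_ifs <;> simp)
        (fun i l => ?_) _
      have hg : Measurable fun d : ℕ → Vec p × ℝ =>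
          unitScore F β₀ (d i) j * unitScore F β₀ (d l) j :=
        ((hcm j).comp (measurable_pi_apply i)).mul ((hcm j).comp (measurable_pi_apply l))
      -- The block indicators are functions of the partition, the scores functions of the data.
      exact (hpart.indep m).symm.comp ((ham i).mul (ham l)) hg
    refine isBigOP_of_integral_sq_le (C := ∫ ω, W j 0 ω * W j 0 ω ∂P) (fun m => ?_) (fun m => ?_)
    · simp_rw [mul_pow]
      exact (key m).1.const_mul _
    · simp_rw [mul_pow]
      rw [integral_const_mul, inv_pow, Real.sq_sqrt (Nat.cast_nonneg _)]
      rcases Nat.eq_zero_or_pos (nTot n m) with h0 | h0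
      · rw [h0]
        simpa using integral_nonneg fun ω => mul_self_nonneg (W j 0 ω)
      · rw [inv_mul_le_iff₀ (by exact_mod_cast h0)]
        exact (key m).2
  have habs : ∀ j, IsBigOP P (fun m ω => |(Real.sqrt (nTot n m))⁻¹ *
      ∑ i ∈ Finset.range (nTot n m), (if part m ω i = k then 1 else 0) * W j i ω|)
      fun _ => 1 := fun j => (hcoord j).mono (.of_forall fun z => by rw [abs_abs])
  refine (IsBigOP.sum Finset.univ fun j _ => habs j).mono (.of_forall fun z => ?_)
  rw [abs_of_nonneg (norm_nonneg _)]
  refine (norm_le_l1 _).trans (le_trans (le_of_eq ?_) (le_abs_self _))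
  refine Finset.sum_congr rfl fun j _ => ?_
  rw [PiLp.smul_apply, smul_eq_mul, scoreSum, block, Finset.sum_filter, WithLp.ofLp_sum,
    Finset.sum_apply]
  congr 2
  refine Finset.sum_congr rfl fun i _ => ?_
  simp only [hWdef, unitScore]
  split_ifs <;> simp

lemma isBigOP_scoreSum_range [IsProbabilityMeasure P] (h : IsGLMSample P F x y β₀)
    (hreg : IsRegularOn F β₀ V δ L A M) (hV : ∀ i, ∀ᵐ ω ∂P, x i ω ∈ V)
    (hpart : IsRandomPartition P x y n part)
    (hmean : ∀ t, ∫ ω, (inner ℝ (unitScore F β₀ (x 0 ω, y 0 ω)) t : ℝ) ∂P = 0) :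
    IsBigOP P (fun m ω => ‖(Real.sqrt (nTot n m))⁻¹ •
      scoreSum F (Finset.range (nTot n m)) (fun i => x i ω) (fun i => y i ω) β₀‖)
      fun _ => 1 := by
  refine (IsBigOP.sum Finset.univ fun k _ =>
    isBigOP_scoreSum_block h hreg hV hpart hmean k).mono (.of_forall fun z => ?_)
  rw [abs_of_nonneg (norm_nonneg _), scoreSum_range_eq_sum (part := part), Finset.smul_sum]
  exact (norm_sum_le _ _).trans (le_abs_self _)

/-- The lasso rate for a fixed dimension is `n_k^{-1/2}`. -/
lemma isBigOP_sqrt_mul_l1 {βLas : ℕ → Fin K → Ω → Vec p} (hp : 0 < p)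
    (hn : Tendsto (nMin n) atTop atTop) (k : Fin K)
    (hrate : IsBigOP P (fun m ω => l1 (βLas m k ω - β₀))
      (fun m => sparsity β₀ * tuning n p m k)) :
    IsBigOP P (fun m ω => Real.sqrt (n m k) * l1 (βLas m k ω - β₀)) fun _ => 1 := by
  intro ε hε
  obtain ⟨C, hC⟩ := hrate ε hε
  refine ⟨C * (sparsity β₀ * Real.sqrt (Real.log p)), ?_⟩
  filter_upwards [hC, (tendsto_blockSize hn k).eventually_gt_atTop 0] with m hm hpos
  refine le_trans (measure_mono fun ω hω => ?_) hm
  simp only [Set.mem_ofPred_eq, mul_one, tuning] at hω ⊢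
  have hsq : 0 < Real.sqrt (n m k) := Real.sqrt_pos.2 (by exact_mod_cast hpos)
  rw [abs_mul, abs_of_pos hsq] at hω
  rw [Real.sqrt_div (Real.log_nonneg (by exact_mod_cast hp)), mul_div_assoc', mul_div_assoc',
    div_lt_iff₀ hsq]
  linarith

lemma tendsto_zero_of_isBigOP_sqrt_mul {N : ℕ → ℕ} (hN : Tendsto N atTop atTop)
    {Z : ℕ → Ω → ℝ} (hZ : IsBigOP P (fun m ω => Real.sqrt (N m) * Z m ω) fun _ => 1) :
    Tendsto (fun z : ℕ × Ω => Z z.1 z.2) (whp P) (𝓝 0) := by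
  refine (hZ.mul_tendsto_zero (W := fun m _ => (Real.sqrt (N m))⁻¹)
    (tendsto_inv_sqrt_whp hN)).congr' ?_
  filter_upwards [eventually_pos_whp hN] with z hz
  have hsq : 0 < Real.sqrt (N z.1) := Real.sqrt_pos.2 (by exact_mod_cast hz)
  field_simp

/-- `CondC1` gives uniform regularity on the covariate vectors in a ball. -/
lemma CondC1.exists_isRegularOn {𝒳 : Set (Vec p)} (hC1 : CondC1 P F x y β₀ 𝒳) (hM : 0 ≤ M) :
    ∃ δ L A, IsRegularOn F β₀ (𝒳 ∩ {v | ‖v‖ ≤ M}) δ L A M := by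
  obtain ⟨-, -, -, δ, hδ, hmem, hvar, L, hL⟩ := hC1
  obtain ⟨a, ha, A, hA⟩ := hvar β₀ (by simpa [l1] using hδ)
  refine ⟨δ, |L|, |A|, hδ, abs_nonneg _, abs_nonneg _, hM, fun β hβ v hv => hmem β hβ v hv.1, ?_,
    fun β hβ v hv => (hL β hβ v hv.1).trans ?_, fun v hv => ((hA v hv.1).2).trans (le_abs_self _),
    fun v hv => hv.2⟩
  · intro β hβ v hv
    obtain ⟨a', ha', A', hA'⟩ := hvar β hβ
    exact ha'.trans_le (hA' v hv.1).1
  · exact mul_le_mul_of_nonneg_right (le_abs_self L) (abs_nonneg _)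

lemma CondC1.integral_inner_unitScore {𝒳 : Set (Vec p)} (hC1 : CondC1 P F x y β₀ 𝒳) (t : Vec p) :
    ∫ ω, (inner ℝ (unitScore F β₀ (x 0 ω, y 0 ω)) t : ℝ) ∂P = 0 := by
  obtain ⟨-, hint, hzero, -⟩ := hC1
  simp_rw [real_inner_comm t]
  have := integral_inner (𝕜 := ℝ) hint t
  rw [hzero, inner_zero_right] at this
  exact this

end Asymptotics

/-! ### Asymptotic normality of the two estimators -/

section Main

variable {Ω : Type*} [MeasurableSpace Ω] {P : Measure Ω}
  {p K : ℕ} {F : ExpFamily} {β₀ : Vec p} {x : ℕ → Ω → Vec p} {y : ℕ → Ω → ℝ}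
  {n : ℕ → Fin K → ℕ} {part : ℕ → Ω → ℕ → Fin K} {V : Set (Vec p)} {δ L A M : ℝ}

/-- The block information matrices at consistent estimates are positive definite with probability
tending to one. -/
lemma eventually_info_posDef (hreg : IsRegularOn F β₀ V δ L A M)
    (hV : ∀ i, ∀ᵐ ω ∂P, x i ω ∈ V) (hp : 0 < p) {b : ℝ} (hb : 0 < b)
    (hsing : WithHighProb P fun m ω => ∀ k,
      b ≤ singVal (block n part m k ω) (fun i => x i ω) (p - 1))
    {βLas : ℕ → Fin K → Ω → Vec p}
    (hLas : ∀ k, Tendsto (fun z : ℕ × Ω => l1 (βLas z.1 k z.2 - β₀)) (whp P) (𝓝 0))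
    {φHat : ℕ → Fin K → Ω → ℝ}
    (hφ : ∀ k, Tendsto (fun z : ℕ × Ω => φHat z.1 k z.2) (whp P) (𝓝 F.φ)) :
    ∀ᶠ z in whp P, ∀ k, (info F (block n part z.1 k z.2) (fun i => x i z.2)
      (φHat z.1 k z.2) (βLas z.1 k z.2)).PosDef := by
  have hVall : ∀ᶠ z in whp P, ∀ i, x i z.2 ∈ V :=
    eventually_whp_of_ae (A := fun _ ω => ∀ i, x i ω ∈ V) fun _ => ae_all_iff.2 hV
  filter_upwards [hVall, eventually_whp.2 hsing,
    eventually_all.2 fun k => (hLas k).eventually_lt_const hreg.δ_pos,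
    eventually_all.2 fun k => (hφ k).eventually_const_lt F.φ_pos] with z hzV hzs hzL hzφ k
  exact info_posDef hp (hb.trans_le (hzs k)) (hzφ k)
    fun i _ => hreg.varFn_pos _ (hzL k) _ (hzV i)

lemma tendsto_sum_remainder {r T e v : Fin K → ℕ → Ω → ℝ} (C : ℝ)
    (hr : ∀ k, Tendsto (fun z : ℕ × Ω => r k z.1 z.2) (whp P) (𝓝 1))
    (hT : ∀ k, IsBigOP P (T k) fun _ => 1) (he : ∀ k, IsBigOP P (e k) fun _ => 1)
    (hv : ∀ k, Tendsto (fun z : ℕ × Ω => v k z.1 z.2) (whp P) (𝓝 0)) :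
    Tendsto (fun z : ℕ × Ω => ∑ k, (|r k z.1 z.2 - 1| * T k z.1 z.2 +
      |r k z.1 z.2| * C * (e k z.1 z.2 * v k z.1 z.2))) (whp P) (𝓝 0) := by
  have hk : ∀ k, Tendsto (fun z : ℕ × Ω => |r k z.1 z.2 - 1| * T k z.1 z.2 +
      |r k z.1 z.2| * C * (e k z.1 z.2 * v k z.1 z.2)) (whp P) (𝓝 0) := fun k => by
    have hr0 : Tendsto (fun z : ℕ × Ω => |r k z.1 z.2 - 1|) (whp P) (𝓝 0) := by
      simpa using ((hr k).sub_const 1).abs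
    have h1 := (hT k).mul_tendsto_zero (W := fun m ω => |r k m ω - 1|) hr0
    have h2 := ((hr k).abs.mul_const C).mul ((he k).mul_tendsto_zero (hv k))
    have h3 := h1.add h2
    simp only [mul_zero, add_zero] at h3
    exact h3.congr fun z => by ring
  simpa using tendsto_finsetSum Finset.univ fun k _ => hk k

lemma tendsto_sum_coefficient {r v : Fin K → ℕ → Ω → ℝ} (B C : ℝ)
    (hr : ∀ k, Tendsto (fun z : ℕ × Ω => r k z.1 z.2) (whp P) (𝓝 1))
    (hv : ∀ k, Tendsto (fun z : ℕ × Ω => v k z.1 z.2) (whp P) (𝓝 0)) :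
    Tendsto (fun z : ℕ × Ω => ∑ k, (|r k z.1 z.2 - 1| * B +
      |r k z.1 z.2| * (C * v k z.1 z.2))) (whp P) (𝓝 0) := by
  have hk : ∀ k, Tendsto (fun z : ℕ × Ω => |r k z.1 z.2 - 1| * B +
      |r k z.1 z.2| * (C * v k z.1 z.2)) (whp P) (𝓝 0) := fun k => by
    simpa using (((hr k).sub_const 1).abs.mul_const B).add
      ((hr k).abs.mul ((hv k).const_mul C))
  simpa using tendsto_finsetSum Finset.univ fun k _ => hk k

variable [IsProbabilityMeasure P]

/-- If the design matrices have trivial kernels, no hyperplane contains the covariates. -/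
lemma eq_zero_of_ae_inner_eq_zero (h : IsGLMSample P F x y β₀) (hK : 0 < K) (hp : 0 < p)
    {b : ℝ} (hb : 0 < b)
    (hsing : WithHighProb P fun m ω => ∀ k,
      b ≤ singVal (block n part m k ω) (fun i => x i ω) (p - 1))
    {v : Vec p} (hv : ∀ᵐ ω ∂P, (inner ℝ (x 0 ω) v : ℝ) = 0) : v = 0 := by
  have hall : ∀ᵐ ω ∂P, ∀ i, (inner ℝ (x i ω) v : ℝ) = 0 := ae_all_iff.2 fun i =>
    ((h.ident_x i).comp (measurable_inner_const v)).symm.ae_snd (p := fun r => r = 0)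
      (measurableSet_singleton 0) hv
  obtain ⟨m, hm⟩ := ((tendsto_order.1 hsing).2 1 one_pos).exists
  have hnot : P {ω | ¬ ∀ i, (inner ℝ (x i ω) v : ℝ) = 0} = 0 := ae_iff.1 hall
  obtain ⟨ω, hω⟩ : ∃ ω, (∀ k, b ≤ singVal (block n part m k ω) (fun i => x i ω) (p - 1)) ∧
      ∀ i, (inner ℝ (x i ω) v : ℝ) = 0 := by
    by_contra hc
    push Not at hc
    have hcover : (Set.univ : Set Ω) ⊆
        {ω | ¬ ∀ k, b ≤ singVal (block n part m k ω) (fun i => x i ω) (p - 1)} ∪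
        {ω | ¬ ∀ i, (inner ℝ (x i ω) v : ℝ) = 0} := fun ω _ => by
      by_cases h1 : ∀ k, b ≤ singVal (block n part m k ω) (fun i => x i ω) (p - 1)
      · exact Or.inr (not_forall.2 (hc ω h1))
      · exact Or.inl h1
    have := (measure_mono hcover).trans (measure_union_le (μ := P) _ _)
    rw [measure_univ, hnot, add_zero] at this
    exact absurd hm (not_lt.2 this)
  exact eq_zero_of_singVal_pos hp (hb.trans_le (hω.1 ⟨0, hK⟩)) fun i _ => hω.2 i

/-- The asymptotic normality criterion for estimators in the generalised linear model. -/
lemma IsGLMSample.isAsympNormal (h : IsGLMSample P F x y β₀) (hreg : IsRegularOn F β₀ V δ L A M)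
    (hV : ∀ i, ∀ᵐ ω ∂P, x i ω ∈ V) (hpart : IsRandomPartition P x y n part)
    (hmean : ∀ t, ∫ ω, (inner ℝ (unitScore F β₀ (x 0 ω, y 0 ω)) t : ℝ) ∂P = 0)
    (hJ : (fisherInfo P F x β₀).PosDef) (hN : Tendsto (nTot n) atTop atTop)
    {βhat : ℕ → Ω → Vec p} (hβ : ∀ m, Measurable (βhat m)) {a c : ℕ × Ω → ℝ}
    (ha : Tendsto a (whp P) (𝓝 0)) (hc : Tendsto c (whp P) (𝓝 0))
    (hlin : ∀ᶠ z in whp P,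
      ‖act (fisherInfo P F x β₀) (Real.sqrt (nTot n z.1) • (βhat z.1 z.2 - β₀)) -
        (Real.sqrt (nTot n z.1))⁻¹ • scoreSum F (Finset.range (nTot n z.1)) (fun i => x i z.2)
          (fun i => y i z.2) β₀‖
        ≤ a z + c z * ‖Real.sqrt (nTot n z.1) • (βhat z.1 z.2 - β₀)‖) :
    IsBigOP P (fun m ω => ‖Real.sqrt (nTot n m) • (βhat m ω - β₀)‖) (fun _ => 1) ∧
      IsAsympNormal P β₀ n βhat (fisherInfo P F x β₀)⁻¹ :=
  isAsympNormal_of_linearisation (X := fun i ω => unitScore F β₀ (x i ω, y i ω)) hJ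
    (fun i => measurable_unitScore.comp ((h.measurable_x i).prodMk (h.measurable_y i)))
    (h.indep.comp (fun _ => unitScore F β₀) fun _ => measurable_unitScore)
    (fun i => (h.ident i).comp measurable_unitScore)
    (fun t => (unitScore_second_moment h hreg hV t).1) hmean
    (fun t => (unitScore_second_moment h hreg hV t).2) hN
    (isBigOP_scoreSum_range h hreg hV hpart hmean) hβ ha hc hlin

lemma tendsto_sum_abs_sub_info (h : IsGLMSample P F x y β₀) (hreg : IsRegularOn F β₀ V δ L A M)
    (hV : ∀ i, ∀ᵐ ω ∂P, x i ω ∈ V) {N : ℕ → ℕ} (hN : Tendsto N atTop atTop) :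
    Tendsto (fun z : ℕ × Ω => ∑ a, ∑ b, |fisherInfo P F x β₀ a b -
      info F (Finset.range (N z.1)) (fun i => x i z.2) F.φ β₀ a b|) (whp P) (𝓝 0) := by
  rw [show (0 : ℝ) = ∑ _a : Fin p, ∑ _b : Fin p, 0 by simp]
  refine tendsto_finsetSum _ fun a _ => tendsto_finsetSum _ fun b _ => ?_
  have := ((tendsto_const_nhds (x := fisherInfo P F x β₀ a b)).sub
    (tendsto_info h hreg hV hN a b)).abs
  simpa using this

/-- Asymptotic normality of the information-weighted average of the one-step estimators. -/
theorem isAsympNormal_of_eventually_eq_weightedAverage (h : IsGLMSample P F x y β₀)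
    (hreg : IsRegularOn F β₀ V δ L A M)
    (hV : ∀ i, ∀ᵐ ω ∂P, x i ω ∈ V) (hpart : IsRandomPartition P x y n part)
    (hmean : ∀ t, ∫ ω, (inner ℝ (unitScore F β₀ (x 0 ω, y 0 ω)) t : ℝ) ∂P = 0)
    (hJ : (fisherInfo P F x β₀).PosDef) (hK : 0 < K) (hn : Tendsto (nMin n) atTop atTop)
    {βLas : ℕ → Fin K → Ω → Vec p}
    (hrate : ∀ k, IsBigOP P (fun m ω => Real.sqrt (n m k) * l1 (βLas m k ω - β₀)) fun _ => 1)
    {φHat : ℕ → Fin K → Ω → ℝ}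
    (hφ : ∀ k, Tendsto (fun z : ℕ × Ω => φHat z.1 k z.2) (whp P) (𝓝 F.φ))
    (hI : ∀ᶠ z in whp P, ∀ k, (info F (block n part z.1 k z.2) (fun i => x i z.2)
      (φHat z.1 k z.2) (βLas z.1 k z.2)).PosDef)
    {βDac : ℕ → Ω → Vec p} (hDac_meas : ∀ m, Measurable (βDac m))
    (hDac : ∀ᶠ z in whp P, βDac z.1 z.2 = weightedAverage F
      (fun k => block n part z.1 k z.2) (fun i => x i z.2) (fun i => y i z.2)
      (fun k => φHat z.1 k z.2) (fun k => βLas z.1 k z.2)) :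
    IsBigOP P (fun m ω => ‖Real.sqrt (nTot n m) • (βDac m ω - β₀)‖) (fun _ => 1) ∧
      IsAsympNormal P β₀ n βDac (fisherInfo P F x β₀)⁻¹ := by
  have hN := tendsto_nTot hK hn
  have hl1 : ∀ k, Tendsto (fun z : ℕ × Ω => l1 (βLas z.1 k z.2 - β₀)) (whp P) (𝓝 0) := fun k =>
    tendsto_zero_of_isBigOP_sqrt_mul (N := fun m => n m k)
      (Z := fun m ω => l1 (βLas m k ω - β₀)) (tendsto_blockSize hn k) (hrate k)
  have hnorm : ∀ k, Tendsto (fun z : ℕ × Ω => ‖βLas z.1 k z.2 - β₀‖) (whp P) (𝓝 0) := fun k =>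
    squeeze_zero (fun z => norm_nonneg (βLas z.1 k z.2 - β₀))
      (fun z => norm_le_l1 (βLas z.1 k z.2 - β₀)) (hl1 k)
  have hratio : ∀ k, Tendsto (fun z : ℕ × Ω => F.φ / φHat z.1 k z.2) (whp P) (𝓝 1) := fun k => by
    have := (tendsto_const_nhds (x := F.φ)).div (hφ k) F.φ_pos.ne'
    rwa [div_self F.φ_pos.ne'] at this
  have hsq : ∀ k, IsBigOP P (fun m ω => Real.sqrt (n m k) * ‖βLas m k ω - β₀‖) fun _ => 1 :=
    fun k => (hrate k).mono (.of_forall fun z => by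
      rw [abs_of_nonneg (by positivity)]
      exact (mul_le_mul_of_nonneg_left (norm_le_l1 _) (Real.sqrt_nonneg _)).trans (le_abs_self _))
  have ha : Tendsto (fun z : ℕ × Ω => ∑ k, (|F.φ / φHat z.1 k z.2 - 1| *
        ‖(Real.sqrt (nTot n z.1))⁻¹ • scoreSum F (block n part z.1 k z.2) (fun i => x i z.2)
          (fun i => y i z.2) β₀‖ +
        |F.φ / φHat z.1 k z.2| * (2 * (L * M ^ 3 / F.φ)) *
          (Real.sqrt (n z.1 k) * ‖βLas z.1 k z.2 - β₀‖ * ‖βLas z.1 k z.2 - β₀‖)))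
      (whp P) (𝓝 0) := by
    exact tendsto_sum_remainder (r := fun k m ω => F.φ / φHat m k ω)
      (T := fun k m ω => ‖(Real.sqrt (nTot n m))⁻¹ • scoreSum F (block n part m k ω)
        (fun i => x i ω) (fun i => y i ω) β₀‖)
      (e := fun k m ω => Real.sqrt (n m k) * ‖βLas m k ω - β₀‖)
      (v := fun k m ω => ‖βLas m k ω - β₀‖) _ hratio
      (fun k => isBigOP_scoreSum_block h hreg hV hpart hmean k) hsq hnorm
  have hc : Tendsto (fun z : ℕ × Ω => (∑ a, ∑ b, |fisherInfo P F x β₀ a b -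
      info F (Finset.range (nTot n z.1)) (fun i => x i z.2) F.φ β₀ a b|) +
        ∑ k, (|F.φ / φHat z.1 k z.2 - 1| * (A * M ^ 2 / F.φ) +
          |F.φ / φHat z.1 k z.2| * (L * M ^ 3 / F.φ * ‖βLas z.1 k z.2 - β₀‖)))
      (whp P) (𝓝 0) := by
    have hcoef := tendsto_sum_coefficient (P := P) (r := fun k m ω => F.φ / φHat m k ω)
      (v := fun k m ω => ‖βLas m k ω - β₀‖) (A * M ^ 2 / F.φ) (L * M ^ 3 / F.φ) hratio hnorm
    simpa only [add_zero] using (tendsto_sum_abs_sub_info h hreg hV hN).add hcoef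
  refine h.isAsympNormal hreg hV hpart hmean hJ hN hDac_meas ha hc ?_
  have hVall : ∀ᶠ z in whp P, ∀ i, x i z.2 ∈ V :=
    eventually_whp_of_ae (A := fun _ ω => ∀ i, x i ω ∈ V) fun _ => ae_all_iff.2 hV
  filter_upwards [hVall, hDac, hI,
    eventually_all.2 fun k => (hl1 k).eventually_lt_const hreg.δ_pos,
    eventually_all.2 fun k => eventually_pos_whp (P := P) (tendsto_blockSize hn k)]
    with z hzV hzD hzI hzL hzn
  have hcard := fun k => hpart.card_block z.1 k z.2
  have key := norm_linearisation_weightedAverage hreg (t := Finset.range (nTot n z.1))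
    (s := fun k => block n part z.1 k z.2) (x := fun i => x i z.2) (y := fun i => y i z.2) hK
    (fun k => by rw [hcard]; exact hzn k) (fun f => sum_block f z.1 z.2)
    (fun k => by rw [hcard, Finset.card_range]; exact le_nTot z.1 k) hzV hzL hzI
    (fisherInfo P F x β₀)
  rw [← hzD] at key
  simpa only [hcard, Finset.card_range] using key

/-- Asymptotic normality of the maximum likelihood estimator of the full data. -/
theorem isAsympNormal_mle (h : IsGLMSample P F x y β₀) (hreg : IsRegularOn F β₀ V δ L A M)
    (hV : ∀ i, ∀ᵐ ω ∂P, x i ω ∈ V) (hpart : IsRandomPartition P x y n part)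
    (hmean : ∀ t, ∫ ω, (inner ℝ (unitScore F β₀ (x 0 ω, y 0 ω)) t : ℝ) ∂P = 0)
    (hJ : (fisherInfo P F x β₀).PosDef) (hN : Tendsto (nTot n) atTop atTop)
    {βFull : ℕ → Ω → Vec p} (hmeas : ∀ m, Measurable (βFull m))
    (hmax : WithHighProb P fun m ω =>
      IsArgmax (likelihood F (Finset.range (nTot n m)) (fun i => x i ω) (fun i => y i ω))
        (paramSet F (Finset.range (nTot n m)) (fun i => x i ω)) (βFull m ω)) :
    IsAsympNormal P β₀ n βFull (fisherInfo P F x β₀)⁻¹ := by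
  have hφ := F.φ_pos
  have hL := hreg.L_nonneg
  have hM := hreg.M_nonneg
  have hVall : ∀ᶠ z in whp P, ∀ i, x i z.2 ∈ V :=
    eventually_whp_of_ae (A := fun _ ω => ∀ i, x i ω ∈ V) fun _ => ae_all_iff.2 hV
  have hq := tendsto_sum_abs_sub_info h hreg hV hN
  obtain ⟨κ, hκ, hκJ⟩ := exists_pos_le_inner_act hJ
  have hscore := (isBigOP_scoreSum_range h hreg hV hpart hmean).mul_tendsto_zero
    (W := fun m _ => (Real.sqrt (nTot n m))⁻¹) (tendsto_inv_sqrt_whp hN)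
  have hcons : Tendsto (fun z : ℕ × Ω => ‖βFull z.1 z.2 - β₀‖) (whp P) (𝓝 0) := by
    refine Metric.tendsto_nhds.2 fun ε hε => ?_
    set C := L * M ^ 3 / F.φ with hC
    have hC0 : 0 ≤ C := by positivity
    -- A radius below `ε` at which the quadratic part of the log-likelihood dominates.
    obtain ⟨ρ, hρ, hρε, hρδ, hρC⟩ : ∃ ρ > 0, ρ < ε ∧ p * ρ < δ ∧ C * ρ < κ / 4 := by
      have h1 : ∀ᶠ ρ in 𝓝[>] (0 : ℝ), ρ < ε ∧ p * ρ < δ ∧ C * ρ < κ / 4 := by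
        have hlt : ∀ (d e : ℝ), 0 < e → ∀ᶠ ρ in 𝓝[>] (0 : ℝ), d * ρ < e := fun d e he => by
          have hc : Tendsto (fun ρ : ℝ => d * ρ) (𝓝[>] 0) (𝓝 (d * 0)) :=
            (tendsto_id.const_mul d).mono_left nhdsWithin_le_nhds
          exact hc.eventually_lt_const (by simpa using he)
        filter_upwards [hlt 1 ε hε, hlt p δ hreg.δ_pos, hlt C (κ / 4) (by positivity)]
          with ρ h1 h2 h3
        exact ⟨by simpa using h1, h2, h3⟩
      obtain ⟨ρ, h2, h3⟩ := (h1.and self_mem_nhdsWithin).exists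
      exact ⟨ρ, h3, h2⟩
    filter_upwards [hVall, eventually_whp.2 hmax, eventually_pos_whp (P := P) hN,
      hq.eventually_lt_const (show 0 < κ / 4 by positivity),
      hscore.eventually_lt_const (show 0 < κ / 4 * ρ by positivity)] with z hzV hzm hzN hzq hzs
    have hNpos : (0 : ℝ) < nTot n z.1 := by exact_mod_cast hzN
    have hs : 0 < Real.sqrt (nTot n z.1) := Real.sqrt_pos.2 hNpos
    rw [norm_smul, norm_inv, Real.norm_eq_abs, abs_of_pos hs, mul_right_comm, ← mul_inv,
      Real.mul_self_sqrt hNpos.le, inv_mul_lt_iff₀ hNpos] at hzs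
    have := norm_mle_sub_le hreg hzV hzm (by simpa using hzN) hκJ hρ hρδ
      (by simpa using hzs) hzq hρC
    rw [dist_zero_right, norm_norm]
    exact this.trans_lt hρε
  have hc : Tendsto (fun z : ℕ × Ω => (∑ a, ∑ b, |fisherInfo P F x β₀ a b -
      info F (Finset.range (nTot n z.1)) (fun i => x i z.2) F.φ β₀ a b|) +
        L * M ^ 3 / F.φ * ‖βFull z.1 z.2 - β₀‖) (whp P) (𝓝 0) := by
    simpa using hq.add (hcons.const_mul (L * M ^ 3 / F.φ))
  refine (h.isAsympNormal hreg hV hpart hmean hJ hN hmeas tendsto_const_nhds hc ?_).2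
  have hl1 : Tendsto (fun z : ℕ × Ω => p * ‖βFull z.1 z.2 - β₀‖) (whp P) (𝓝 0) := by
    simpa using hcons.const_mul (p : ℝ)
  filter_upwards [hVall, eventually_whp.2 hmax, eventually_pos_whp (P := P) hN,
    hl1.eventually_lt_const hreg.δ_pos] with z hzV hzm hzN hzL
  have key := norm_linearisation_mle hreg hzV hzm (by simpa using hzN)
    ((l1_le_norm _).trans_lt hzL) (fisherInfo P F x β₀)
  rw [Finset.card_range] at key
  simpa using key

end Main

end DivideCombine

end

open DivideCombine in
theorem theorem2 {Ω : Type*} [MeasurableSpace Ω] (P : Measure Ω) [IsProbabilityMeasure P]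
    {p K : ℕ} (hK : 0 < K) (F : ExpFamily) (β₀ : Vec p) (𝒳 : Set (Vec p))
    -- the data, the block sizes, and the partition into `K` blocks
    (x : ℕ → Ω → Vec p) (y : ℕ → Ω → ℝ) (hdata : IsGLMSample P F x y β₀)
    (n : ℕ → Fin K → ℕ) (hn : Tendsto (nMin n) atTop atTop)
    (part : ℕ → Ω → ℕ → Fin K) (hpart : IsRandomPartition P x y n part)
    -- the block lasso estimators and the dispersion estimators (`φHat = φ` if `φ` is known)
    (βLas : ℕ → Fin K → Ω → Vec p) (hLas_meas : ∀ m k, Measurable (βLas m k))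
    (hLas : ∀ k, WithHighProb P fun m ω =>
      IsArgmax (penLik F (block n part m k ω) (fun i => x i ω) (fun i => y i ω) (tuning n p m k))
        (paramSet F (block n part m k ω) (fun i => x i ω)) (βLas m k ω))
    (φHat : ℕ → Fin K → Ω → ℝ) (hφ_meas : ∀ m k, Measurable (φHat m k))
    (hφ : ∀ k, TendstoInMeasure P (fun m => φHat m k) atTop (fun _ => F.φ))
    -- the regularity conditions
    (hC1 : CondC1 P F x y β₀ 𝒳)
    (hC2 : CondC2 P x (block n part))
    (hC3 : CondC3 P x β₀ n (block n part) βLas)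
    -- the divide-and-combine estimator
    (βDac : ℕ → Ω → Vec p) (hDac_meas : ∀ m, Measurable (βDac m))
    (hDac : WithHighProb P fun m ω =>
      IsArgmax (prodConfDensity F (fun k => block n part m k ω) (fun i => x i ω)
        (fun i => y i ω) (fun k => φHat m k ω) (fun k => βLas m k ω)) Set.univ (βDac m ω)) :
    -- it is the unique maximiser, and it is the weighted average
    (WithHighProb P fun m ω =>
      βDac m ω = weightedAverage F (fun k => block n part m k ω) (fun i => x i ω)
        (fun i => y i ω) (fun k => φHat m k ω) (fun k => βLas m k ω) ∧
      ∀ γ, IsArgmax (prodConfDensity F (fun k => block n part m k ω) (fun i => x i ω)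
        (fun i => y i ω) (fun k => φHat m k ω) (fun k => βLas m k ω)) Set.univ γ ↔
          γ = βDac m ω) ∧
    -- consistency
    TendstoInMeasure P βDac atTop (fun _ => β₀) ∧
    -- the Fisher information is `E {-Ṡ_N (β₀)}`, and it is invertible
    (∀ N : ℕ, 0 < N → ∀ i j,
      Integrable (fun ω => info F (Finset.range N) (fun l => x l ω) F.φ β₀ i j) P ∧
      ∫ ω, info F (Finset.range N) (fun l => x l ω) F.φ β₀ i j ∂P
        = fisherInfo P F x β₀ i j) ∧
    (fisherInfo P F x β₀).PosDef ∧
    -- asymptotic normality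
    IsAsympNormal P β₀ n βDac (fisherInfo P F x β₀)⁻¹ ∧
    -- the full-data maximum likelihood estimator has the same limit distribution
    (∀ βFull : ℕ → Ω → Vec p, (∀ m, Measurable (βFull m)) →
      (WithHighProb P fun m ω =>
        IsArgmax (likelihood F (Finset.range (nTot n m)) (fun i => x i ω) (fun i => y i ω))
          (paramSet F (Finset.range (nTot n m)) (fun i => x i ω)) (βFull m ω)) →
      IsAsympNormal P β₀ n βFull (fisherInfo P F x β₀)⁻¹) := by
  have hC1' := hC1
  obtain ⟨h𝒳, -⟩ := hC1'
  obtain ⟨hbd, b, hb, B, -, hsing⟩ := hC2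
  obtain ⟨hp, -, -, hrates⟩ := hC3
  obtain ⟨M, hM, hxM⟩ := exists_norm_le hdata hK hn hbd
  obtain ⟨δ, L, A, hreg⟩ := hC1.exists_isRegularOn hM
  have hV : ∀ i, ∀ᵐ ω ∂P, x i ω ∈ 𝒳 ∩ {v | ‖v‖ ≤ M} := fun i => (h𝒳 i).and (hxM i)
  have hmean := hC1.integral_inner_unitScore
  have hN := tendsto_nTot hK hn
  have hsing' : WithHighProb P fun m ω => ∀ k,
      b ≤ singVal (block n part m k ω) (fun i => x i ω) (p - 1) :=
    eventually_whp.1 ((eventually_whp.2 hsing).mono fun z hz k => (hz k).1)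
  have hJ : (fisherInfo P F x β₀).PosDef := fisherInfo_posDef hdata hreg hV
    fun v hv => eq_zero_of_ae_inner_eq_zero hdata hK hp hb hsing' hv
  have hrate := fun k => isBigOP_sqrt_mul_l1 (βLas := βLas) hp hn k (hrates k).1
  have hφ' : ∀ k, Tendsto (fun z : ℕ × Ω => φHat z.1 k z.2) (whp P) (𝓝 F.φ) := fun k =>
    (tendstoInMeasure_const_iff (f := fun m => φHat m k)).1 (hφ k)
  have hI := eventually_info_posDef hreg hV hp hb hsing'
    (fun k => tendsto_zero_of_isBigOP_sqrt_mul (N := fun m => n m k)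
      (Z := fun m ω => l1 (βLas m k ω - β₀)) (tendsto_blockSize hn k) (hrate k)) hφ'
  have hmax : ∀ᶠ z in whp P, ∀ γ, IsArgmax (prodConfDensity F (fun k => block n part z.1 k z.2)
      (fun i => x i z.2) (fun i => y i z.2) (fun k => φHat z.1 k z.2) (fun k => βLas z.1 k z.2))
      Set.univ γ ↔ γ = weightedAverage F (fun k => block n part z.1 k z.2) (fun i => x i z.2)
        (fun i => y i z.2) (fun k => φHat z.1 k z.2) (fun k => βLas z.1 k z.2) := by
    filter_upwards [hI,
      eventually_all.2 fun k => eventually_pos_whp (P := P) (tendsto_blockSize hn k)]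
      with z hzI hzn γ
    exact isArgmax_prodConfDensity_iff hK
      (fun k => by rw [hpart.card_block]; exact hzn k) hzI γ
  have hDac' : ∀ᶠ z in whp P, βDac z.1 z.2 = weightedAverage F
      (fun k => block n part z.1 k z.2) (fun i => x i z.2) (fun i => y i z.2)
      (fun k => φHat z.1 k z.2) (fun k => βLas z.1 k z.2) := by
    filter_upwards [hmax, eventually_whp.2 hDac] with z hz hzD using (hz _).1 hzD
  obtain ⟨htight, hnormal⟩ := isAsympNormal_of_eventually_eq_weightedAverage hdata hreg hV hpart
    hmean hJ hK hn hrate hφ' hI hDac_meas hDac'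
  refine ⟨?_, ?_, fun N hN0 i j => integral_info_range hdata hreg hV hN0 i j, hJ, hnormal,
    fun βFull hmeas hfull => isAsympNormal_mle hdata hreg hV hpart hmean hJ hN hmeas hfull⟩
  · refine eventually_whp.1 ?_
    filter_upwards [hmax, hDac'] with z hz hzD
    refine ⟨hzD, fun γ => ?_⟩
    rw [hzD]
    exact hz γ
  · refine (tendstoInMeasure_const_iff (f := βDac)).2 (tendsto_iff_norm_sub_tendsto_zero.2 ?_)
    refine tendsto_zero_of_isBigOP_sqrt_mul (N := nTot n) hN (Z := fun m ω => ‖βDac m ω - β₀‖)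
      (htight.mono (.of_forall fun z => ?_))
    rw [norm_smul, Real.norm_eq_abs, abs_of_nonneg (Real.sqrt_nonneg _)]
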